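/- **Setting.** Let $(\Omega,\Sigma,P)$ be a probability space, $\mathcal Y:=(0,\infty)$ with Borel $\sigma$-algebra $\mathfrak B(\mathcal Y)$, and let $\Theta$ be a real random variable with $P(\Theta>0)=1$. Let $N=\{N_t\}_{t\ge 0}$ be a counting process (for every $\omega$: $N_0=0$, finite integer values, non-decreasing right-continuous paths with jumps of size at most one, $\sup_t N_t=\infty$), with arrival times $T_n=\inf\{t: N_t=n\}$ and interarrival process $W=\{W_n\}_{n\ge1}$, $W_n=T_n-T_{n-1}$. Let $X=\{X_n\}_{n\ge1}$ be a sequence of positive random variables, and $S_t=\sum_{k=1}^{N_t}X_k$. Put $\mathcal F_t:=\sigma(\{S_u:u\le t\}\cup\{\Theta\})$; martingales are taken with respect to $\{\mathcal F_t\}_{t\ge0}$. Two probability measures on $\Sigma$ are *progressively equivalent* ($\stackrel{pr}{\sim}$) if they are equivalent (mutually absolutely continuous, $\sim$) on each $\mathcal F_t$, $t\ge 0$. Image measures are denoted by $P_\Theta$, $P_{X_1}$, etc. For a probability measure $R$ on $\Sigma$ consider the conditions - (a1) $W$ and $X$ are $R$-conditionally independent given $\Theta$; - (a2) $\Theta$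 and the sequence $X$ are $R$-independent. For a positive measurable function $g$ on $\mathcal Y$ and $R$ with $R(\Theta>0)=1$, $S$ is an *$R$-CMPP$(g(\Theta),R_{X_1})$* if, under $R$, $X$ is i.i.d. and independent of $N$, and, conditionally given $\Theta$, $N$ has stationary independent increments with $N_t$ Poisson distributed with mean $t\,g(\Theta)$ for each $t>0$. A *regular conditional probability* (r.c.p.) of $R$ over $R_\Theta$ consistent with $\Theta$ is a family $\{R_\theta\}_{\theta\in\mathcal Y}$ of probability measures on $\Sigma$ such that $\theta\mapsto R_\theta(D)$ is measurable and $\int R_\theta(D)\,R_\Theta(d\theta)=R(D)$ for each $D\in\Sigma$, and, for each $B\in\mathfrak B(\mathcal Y)$, $R_\theta(\Theta^{-1}(B))=1$ for $R_\Theta$-almost all $\theta\in B$. Let $\mathcal F_P$ be the class of all functions $\beta(x,\theta)=\alpha(\theta)+\gamma(x)$ on $\mathcal Y\times\mathcal Y$ with $\alpha,\gamma:\mathcal Y\to\mathbb R$ measurable and $\mathbb E_P[e^{\gamma(X_1)}]=1$, and $\mathcal R_+(\mathcal Y)$ the class of all measurable $\xi:\mathcal Y\to\mathbb R$ with $P_\Theta(\{\xi>0\})=1$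 and $\mathbb E_P[\xi(\Theta)]=1$. For $\beta=\alpha+\gamma\in\mathcal F_P$ put $$S_t^{(\beta)}(\theta)=\sum_{k=1}^{N_t}\beta(X_k,\theta),\qquad \widetilde M_t^{(\beta)}(\theta)=e^{S_t^{(\beta)}(\theta)-t\theta(e^{\alpha(\theta)}-1)}.$$ "Essentially unique" means unique up to $P_{X_1}\otimes P_\Theta$-null sets for $\beta$ and up to $P_\Theta$-null sets for $\xi$. Assume that $P$ satisfies (a1) and (a2), that $S$ is a $P$-CMPP$(\Theta,P_{X_1})$, and that $\{P_\theta\}_{\theta\in\mathcal Y}$ is an r.c.p. of $P$ over $P_\Theta$ consistent with $\Theta$. **Proposition 3.4.** Let $g:\mathcal Y\to\mathcal Y$ be measurable and let $Q$ be a probability measure on $\Sigma$ with $Q(\Theta>0)=1$, satisfying (a1) and (a2) and such that $S$ is a $Q$-CMPP$(g(\Theta),Q_{X_1})$. Let $\{Q_\theta\}_{\theta\in\mathcal Y}$ be an r.c.p. of $Q$ over $Q_\Theta$ consistent with $\Theta$. Then the following are equivalent: (i) $Q\stackrel{pr}{\sim}P$. (ii) $Q_{X_1}\sim P_{X_1}$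 and $Q_\Theta\sim P_\Theta$. (iii) $Q_\Theta\sim P_\Theta$; there exists an essentially unique $\beta=\alpha+\gamma\in\mathcal F_P$ such that $g(\theta)=\theta e^{\alpha(\theta)}$ for any $\theta\in\mathcal Y$ and $\gamma=\ln f$, where $f$ is a $P_{X_1}$-a.s. positive Radon–Nikodym derivative of $Q_{X_1}$ with respect to $P_{X_1}$; and there exists a $P_\Theta$-null set $V_*\in\mathfrak B(\mathcal Y)$ such that for any $\theta\in\mathcal Y\setminus V_*$ $$Q_\theta(A)=\int_A\widetilde M_t^{(\beta)}(\theta)\,dP_\theta\qquad\text{for all }0\le s\le t\text{ and }A\in\mathcal F_s,$$ and $\{\widetilde M_t^{(\beta)}(\theta)\}_{t\ge0}$ is a martingale in $\mathcal L^1(P_\theta)$. (iv) There exists an essentially unique pair $(\beta,\xi)\in\mathcal F_P\times\mathcal R_+(\mathcal Y)$, $\beta=\alpha+\gamma$, with $\xi$ a Radon–Nikodym derivative of $Q_\Theta$ with respect to $P_\Theta$, such that $g(\Theta)=\Theta e^{\alpha(\Theta)}$ (on $\{\Theta>0\}$) and $\gamma=\ln f$, where $f$ is a $P_{X_1}$-a.s.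 positive Radon–Nikodym derivative of $Q_{X_1}$ with respect to $P_{X_1}$, and such that, with $M_t^{(\beta)}(\Theta):=\xi(\Theta)\widetilde M_t^{(\beta)}(\Theta)$, $$Q(A)=\int_A M_t^{(\beta)}(\Theta)\,dP\qquad\text{for all }0\le s\le t\text{ and }A\in\mathcal F_s,$$ and $\{M_t^{(\beta)}(\Theta)\}_{t\ge0}$ is a martingale in $\mathcal L^1(P)$. -/

import Mathlib

open MeasureTheory ProbabilityTheory
open scoped NNReal ENNReal

namespace CMPP

noncomputable section

variable {Ω : Type*} [mΩ : MeasurableSpace Ω]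

/-- A counting process with empty exceptional set and without explosion, so that all the values
are finite. Since the values are natural numbers and the paths are monotone, the fourth field says
`N_t = inf_{s > t} N_s` and the fifth one says `N_t ≤ sup_{s < t} N_s + 1`. -/
structure IsCountingProcess (N : ℝ≥0 → Ω → ℕ) : Prop where
  measurable : ∀ t, Measurable (N t)
  zero : ∀ ω, N 0 ω = 0
  mono : ∀ ω, Monotone fun t => N t ω
  right_cont : ∀ ω t, ∃ s, t < s ∧ N s ω = N t ω
  jump : ∀ ω t, 0 < t → ∃ s, s < t ∧ N t ω ≤ N s ω + 1
  unbounded : ∀ ω n, ∃ t, n ≤ N t ω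

/-- A size process: random variables `X 0, X 1, …` (the first size is `X 0`), all of them
positive. -/
structure IsSizeProcess (X : ℕ → Ω → ℝ) : Prop where
  measurable : ∀ n, Measurable (X n)
  pos : ∀ n ω, 0 < X n ω

/-- The arrival times `T_n = inf {t | N_t = n}`. -/
def arrival (N : ℝ≥0 → Ω → ℕ) (n : ℕ) (ω : Ω) : ℝ≥0 := sInf {t | N t ω = n}

/-- The interarrival times; `interarrival N n` is `T_{n+1} - T_n`. -/
def interarrival (N : ℝ≥0 → Ω → ℕ) (n : ℕ) (ω : Ω) : ℝ :=
  (arrival N (n + 1) ω : ℝ) - (arrival N n ω : ℝ)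

/-- The aggregate process `S_t`, the sum of the first `N_t` sizes. -/
def aggregate (N : ℝ≥0 → Ω → ℕ) (X : ℕ → Ω → ℝ) (t : ℝ≥0) (ω : Ω) : ℝ :=
  ∑ k ∈ Finset.range (N t ω), X k ω

theorem measurable_aggregate {N : ℝ≥0 → Ω → ℕ} {X : ℕ → Ω → ℝ} (hN : IsCountingProcess N)
    (hX : IsSizeProcess X) (t : ℝ≥0) : Measurable (aggregate N X t) := by
  have h : Measurable fun p : ℕ × Ω => ∑ k ∈ Finset.range p.1, X k p.2 := by
    refine measurable_from_prod_countable_right fun n => ?_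
    exact Finset.measurable_fun_sum (Finset.range n) fun k _ => hX.measurable k
  exact h.comp ((hN.measurable t).prodMk measurable_id)

/-- The canonical filtration of `S` and `Θ`: `F_t` is generated by `S_u`, `u ≤ t`, and by `Θ`. -/
def filtration (N : ℝ≥0 → Ω → ℕ) (X : ℕ → Ω → ℝ) (Θ : Ω → ℝ) (hN : IsCountingProcess N)
    (hX : IsSizeProcess X) (hΘ : Measurable Θ) : Filtration ℝ≥0 mΩ where
  seq t := (⨆ u : ℝ≥0, ⨆ _ : u ≤ t, MeasurableSpace.comap (aggregate N X u) inferInstance) ⊔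
    MeasurableSpace.comap Θ inferInstance
  mono' s t hst := by
    refine sup_le_sup_right (iSup₂_le fun u hu => ?_) _
    exact le_iSup₂ (f := fun (v : ℝ≥0) (_ : v ≤ t) =>
      MeasurableSpace.comap (aggregate N X v) inferInstance) u (hu.trans hst)
  le' t := sup_le (iSup₂_le fun u _ => (measurable_aggregate hN hX u).comap_le) hΘ.comap_le

/-- Equivalence of measures: they are absolutely continuous with respect to each other. -/
def MeasEquiv {α : Type*} {m : MeasurableSpace α} (μ ν : Measure α) : Prop := μ ≪ ν ∧ ν ≪ μ

/-- Progressive equivalence: equivalence on each member of the filtration. -/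
def ProgEquiv (ℱ : Filtration ℝ≥0 mΩ) (Q P : Measure Ω) : Prop :=
  ∀ t, MeasEquiv (Q.trim (ℱ.le t)) (P.trim (ℱ.le t))

/-- The conditional probability `μ(A | σ(Θ))`. -/
def condProb (μ : Measure Ω) (Θ : Ω → ℝ) (A : Set Ω) : Ω → ℝ :=
  μ[A.indicator (fun _ => (1 : ℝ)) | MeasurableSpace.comap Θ inferInstance]

/-- `Y` and `Z` are conditionally independent given `σ(Θ)`. (The notion in Mathlib asks for a
standard Borel `Ω`.) -/
def CondIndepGiven {α β : Type*} [MeasurableSpace α] [MeasurableSpace β]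
    (μ : Measure Ω) (Θ : Ω → ℝ) (Y : Ω → α) (Z : Ω → β) : Prop :=
  ∀ (A : Set α) (B : Set β), MeasurableSet A → MeasurableSet B →
    condProb μ Θ (Y ⁻¹' A ∩ Z ⁻¹' B) =ᵐ[μ]
      fun ω => condProb μ Θ (Y ⁻¹' A) ω * condProb μ Θ (Z ⁻¹' B) ω

/-- Condition (a1): the processes `W` and `X` are conditionally independent given `Θ`. -/
def CondA1 (μ : Measure Ω) (N : ℝ≥0 → Ω → ℕ) (X : ℕ → Ω → ℝ) (Θ : Ω → ℝ) : Prop :=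
  CondIndepGiven μ Θ (fun ω n => interarrival N n ω) (fun ω n => X n ω)

/-- Condition (a2): `Θ` and the sequence `X` are independent. -/
def CondA2 (μ : Measure Ω) (X : ℕ → Ω → ℝ) (Θ : Ω → ℝ) : Prop :=
  IndepFun Θ (fun ω n => X n ω) μ

/-- `(N, X)` is a risk process: `X` is i.i.d., and `N` and `X` are independent. -/
structure IsRiskProcess (μ : Measure Ω) (N : ℝ≥0 → Ω → ℕ) (X : ℕ → Ω → ℝ) : Prop where
  indep : iIndepFun X μ
  ident : ∀ n, IdentDistrib (X n) (X 0) μ μ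
  indep_proc : IndepFun (fun ω t => N t ω) (fun ω n => X n ω) μ

/-- `N` is a mixed Poisson process with parameter `g(Θ)`: conditionally given `Θ`, the increments
are independent and stationary, and `N_t` has the Poisson distribution with mean `t g(Θ)`. -/
structure IsMPP (μ : Measure Ω) (N : ℝ≥0 → Ω → ℕ) (Θ : Ω → ℝ) (g : ℝ → ℝ) : Prop where
  indep_incr : ∀ (n : ℕ) (t : Fin (n + 1) → ℝ≥0), StrictMono t → ∀ B : Fin n → Set ℕ,
    condProb μ Θ (⋂ i, {ω | N (t i.succ) ω - N (t i.castSucc) ω ∈ B i}) =ᵐ[μ]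
      fun ω => ∏ i, condProb μ Θ {ω' | N (t i.succ) ω' - N (t i.castSucc) ω' ∈ B i} ω
  stat_incr : ∀ s t h : ℝ≥0, s < t → ∀ B : Set ℕ,
    condProb μ Θ {ω | N (t + h) ω - N (s + h) ω ∈ B} =ᵐ[μ]
      condProb μ Θ {ω | N t ω - N s ω ∈ B}
  poisson : ∀ t : ℝ≥0, 0 < t → ∀ B : Set ℕ,
    condProb μ Θ {ω | N t ω ∈ B} =ᵐ[μ]
      fun ω => (poissonMeasure (t * (g (Θ ω)).toNNReal)).real B

/-- The aggregate process of `N` and `X` is a `μ`-CMPP with parameters `g(Θ)` and `μ_{X_1}`. -/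
structure IsCMPP (μ : Measure Ω) (N : ℝ≥0 → Ω → ℕ) (X : ℕ → Ω → ℝ) (Θ : Ω → ℝ)
    (g : ℝ → ℝ) : Prop where
  risk : IsRiskProcess μ N X
  mpp : IsMPP μ N Θ g

/-- The Markov kernel `κ` is a regular conditional probability of `μ` over `μ_Θ` consistent
with `Θ`. (The kernel property is the measurability of `θ ↦ κ θ D`.) -/
structure IsConsistentRCP (κ : Kernel ℝ Ω) (μ : Measure Ω) (Θ : Ω → ℝ) : Prop where
  prob : ∀ θ, IsProbabilityMeasure (κ θ)
  disint : ∀ D, MeasurableSet D → ∫⁻ θ, κ θ D ∂(μ.map Θ) = μ D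
  consistent : ∀ B, MeasurableSet B → ∀ᵐ θ ∂(μ.map Θ), θ ∈ B → κ θ (Θ ⁻¹' B) = 1

/-- `f` is a (real-valued) Radon-Nikodym derivative of `ν` with respect to `μ`, positive
`μ`-almost surely. -/
structure IsPosDensity (f : ℝ → ℝ) (ν μ : Measure ℝ) : Prop where
  measurable : Measurable f
  pos : ∀ᵐ x ∂μ, 0 < f x
  density : ν = μ.withDensity fun x => ENNReal.ofReal (f x)

/-- The function `β(x, θ) = α(θ) + γ(x)`. -/
def betaFn (α γ : ℝ → ℝ) (x θ : ℝ) : ℝ := α θ + γ x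

/-- `β = α + γ` belongs to the class `F_P`. Only the values of `α` and `γ` on `(0, ∞)` matter. -/
structure IsFClass (P : Measure Ω) (X : ℕ → Ω → ℝ) (α γ : ℝ → ℝ) : Prop where
  measurable_alpha : Measurable α
  measurable_gamma : Measurable γ
  integral_eq : ∫ ω, Real.exp (γ (X 0 ω)) ∂P = 1

/-- The class `R_+` of the functions `ξ` with `P_Θ({ξ > 0}) = 1` and `E_P[ξ(Θ)] = 1`. -/
structure IsRClass (P : Measure Ω) (Θ : Ω → ℝ) (ξ : ℝ → ℝ) : Prop where
  measurable : Measurable ξ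
  pos : ∀ᵐ θ ∂(P.map Θ), 0 < ξ θ
  integral_eq : ∫ ω, ξ (Θ ω) ∂P = 1

/-- `γ = ln f` for some `P_{X_1}`-a.s. positive Radon-Nikodym derivative `f` of `Q_{X_1}` with
respect to `P_{X_1}`. The equality is asked for at the points of `(0, ∞)` where `f` is positive. -/
def IsLogDensity (P Q : Measure Ω) (X : ℕ → Ω → ℝ) (γ : ℝ → ℝ) : Prop :=
  ∃ f : ℝ → ℝ, IsPosDensity f (Q.map (X 0)) (P.map (X 0)) ∧
    ∀ x, 0 < x → 0 < f x → γ x = Real.log (f x)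

/-- `S_t^{(β)}(θ)`, the sum of `β(X_k, θ)` over the first `N_t` sizes. -/
def betaAggregate (N : ℝ≥0 → Ω → ℕ) (X : ℕ → Ω → ℝ) (β : ℝ → ℝ → ℝ) (t : ℝ≥0) (θ : ℝ)
    (ω : Ω) : ℝ :=
  ∑ k ∈ Finset.range (N t ω), β (X k ω) θ

/-- The fibre density `exp (S_t^{(β)}(θ) - t θ (e^{α(θ)} - 1))`, where `β = α + γ`. -/
def fibreDensity (N : ℝ≥0 → Ω → ℕ) (X : ℕ → Ω → ℝ) (α γ : ℝ → ℝ) (θ : ℝ) (t : ℝ≥0)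
    (ω : Ω) : ℝ :=
  Real.exp (betaAggregate N X (betaFn α γ) t θ ω - t * θ * (Real.exp (α θ) - 1))

/-- The global density `ξ(Θ) exp (S_t^{(β)}(Θ) - t Θ (e^{α(Θ)} - 1))`, where `β = α + γ`. -/
def globalDensity (N : ℝ≥0 → Ω → ℕ) (X : ℕ → Ω → ℝ) (Θ : Ω → ℝ) (α γ ξ : ℝ → ℝ) (t : ℝ≥0)
    (ω : Ω) : ℝ :=
  ξ (Θ ω) * fibreDensity N X α γ (Θ ω) t ω

/-- `β = α + γ` and `β' = α' + γ'` agree almost everywhere for `P_{X_1} ⊗ P_Θ`. -/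
def BetaAEEq (P : Measure Ω) (X : ℕ → Ω → ℝ) (Θ : Ω → ℝ) (α γ α' γ' : ℝ → ℝ) : Prop :=
  ∀ᵐ p ∂((P.map (X 0)).prod (P.map Θ)), betaFn α' γ' p.1 p.2 = betaFn α γ p.1 p.2

end

end CMPP

namespace CMPP

/-! ### Reading the counts and the sizes off the aggregate path -/

section Paths

/-! Everything reduces to one explicit likelihood ratio. For almost every θ, the fibre measures `Pθ
θ` and `Qθ θ` are concentrated on `Θ = θ`, and under them `N` is Poisson with rate θ, respectively
`g θ`, independent of i.i.d. sizes (`IsCMPP.ae_isPoissonModel`). If `g θ = θ e^{α θ}` and the size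
laws have ratio `e^γ`, then tilting the Poisson weights and the size laws shows that `fibreDensity`
is the density on `F_t` (`ae_fibre_change_of_measure`). The computation is done on the cells where
the increments of `N` along finitely many times are prescribed; there `N_t` is constant and the
density is a constant times a product over the sizes.

Mixing the fibres with `ξ = dQ_Θ/dP_Θ` gives the global density (`global_change_of_measure`). The
martingale property is automatic for densities of a fixed measure along a filtration, and positivity
of the global density gives back progressive equivalence.

From progressive equivalence, equivalence of the laws of `Θ` is seen at time 0. For the sizes, `F_1`
sees `X 0` on `N_1 ≥ 1`, an event of positive probability that is independent of `X`. That `F_t`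
sees counts and sizes at all rests on positivity of the sizes: `S` increases exactly when `N` does.
-/

theorem aggregate_sub {Ω : Type*} {N : ℝ≥0 → Ω → ℕ} {X : ℕ → Ω → ℝ} (ω : Ω) {s t : ℝ≥0} {k : ℕ}
    (hs : N s ω = k) (ht : N t ω = k + 1) :
    aggregate N X t ω - aggregate N X s ω = X k ω := by
  simp [aggregate, hs, ht, Finset.sum_range_succ]

variable {Ω : Type*} [mΩ : MeasurableSpace Ω] {N : ℝ≥0 → Ω → ℕ} {X : ℕ → Ω → ℝ} {Θ : Ω → ℝ}

/-- Take for `b` the first time at which the count exceeds `n`. Right continuity shows that the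
count at `b` is already at least `n + 1`, and since jumps have size at most one, the count is `n`
just before `b`. -/
theorem IsCountingProcess.exists_Ico_eq (hN : IsCountingProcess N) {ω : Ω} {n : ℕ} {T : ℝ≥0}
    (h : n < N T ω) : ∃ a b, a < b ∧ b ≤ T ∧ ∀ s, a ≤ s → s < b → N s ω = n := by
  set U : Set ℝ≥0 := {u | n + 1 ≤ N u ω} with hU
  have hTU : T ∈ U := h
  have hbT : sInf U ≤ T := csInf_le' hTU
  have hbU : n + 1 ≤ N (sInf U) ω := by
    obtain ⟨s, hs, hs'⟩ := hN.right_cont ω (sInf U)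
    obtain ⟨u, hu, hus⟩ := exists_lt_of_csInf_lt ⟨T, hTU⟩ hs
    rw [← hs']
    exact le_trans hu (hN.mono ω hus.le)
  have hb0 : 0 < sInf U := by
    rw [pos_iff_ne_zero]
    intro h0
    rw [h0, hN.zero] at hbU
    omega
  obtain ⟨a, hab, ha⟩ := hN.jump ω (sInf U) hb0
  refine ⟨a, sInf U, hab, hbT, fun s has hsb => ?_⟩
  have h1 : ¬ n + 1 ≤ N s ω := fun hs => notMem_of_lt_csInf' hsb hs
  have h2 : N a ω ≤ N s ω := hN.mono ω has
  omega

/-- A countable set of times up to `T`, containing `T`, at which the paths are sampled. -/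
def timeGrid (T : ℝ≥0) : Set ℝ≥0 :=
  insert T (Set.range (TopologicalSpace.denseSeq ℝ≥0) ∩ Set.Iic T)

theorem countable_timeGrid (T : ℝ≥0) : (timeGrid T).Countable :=
  ((Set.countable_range _).mono Set.inter_subset_left).insert T

theorem le_of_mem_timeGrid {T s : ℝ≥0} (hs : s ∈ timeGrid T) : s ≤ T := by
  rcases hs with rfl | hs
  exacts [le_rfl, hs.2]

/-- A level strictly below `N T` is occupied during an interval of positive length, which the dense
sequence meets. The level `N T` itself may be attained only at `T`, hence the extra point of the
grid. -/
theorem IsCountingProcess.exists_mem_timeGrid (hN : IsCountingProcess N) {ω : Ω} {n : ℕ}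
    {T : ℝ≥0} (h : n ≤ N T ω) : ∃ s ∈ timeGrid T, N s ω = n := by
  rcases h.eq_or_lt with h | h
  · exact ⟨T, Set.mem_insert _ _, h.symm⟩
  · obtain ⟨a, b, hab, hbT, H⟩ := hN.exists_Ico_eq h
    obtain ⟨s, hs, hsr⟩ := (TopologicalSpace.denseRange_denseSeq ℝ≥0).exists_mem_open isOpen_Ioo
      (Set.nonempty_Ioo.2 hab)
    exact ⟨_, Or.inr ⟨⟨s, rfl⟩, (hsr.trans_le hbT).le⟩, H _ hs.le hsr⟩

theorem aggregate_lt_iff (hN : IsCountingProcess N) (hX : IsSizeProcess X) {ω : Ω} {s t : ℝ≥0}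
    (hst : s ≤ t) : aggregate N X s ω < aggregate N X t ω ↔ N s ω < N t ω := by
  constructor
  · intro h
    refine lt_of_le_of_ne (hN.mono ω hst) fun he => ?_
    simp [aggregate, he] at h
  · intro h
    exact Finset.sum_lt_sum_of_subset (Finset.range_mono h.le) (Finset.mem_range.2 h) (by simp)
      (hX.pos _ _) fun j _ _ => (hX.pos _ _).le

variable (hN : IsCountingProcess N) (hX : IsSizeProcess X) (hΘ : Measurable Θ)

theorem measurable_aggregate_filtration {s t : ℝ≥0} (hst : s ≤ t) :
    Measurable[filtration N X Θ hN hX hΘ t] (aggregate N X s) := by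
  have h : MeasurableSpace.comap (aggregate N X s) inferInstance
      ≤ filtration N X Θ hN hX hΘ t :=
    le_trans (le_iSup₂ (f := fun (v : ℝ≥0) (_ : v ≤ t) =>
      MeasurableSpace.comap (aggregate N X v) inferInstance) s hst) le_sup_left
  exact (comap_measurable _).mono h le_rfl

theorem measurable_theta_filtration (t : ℝ≥0) : Measurable[filtration N X Θ hN hX hΘ t] Θ := by
  have h : MeasurableSpace.comap Θ inferInstance ≤ filtration N X Θ hN hX hΘ t := le_sup_right
  exact (comap_measurable _).mono h le_rfl

theorem measurableSet_le_count (n : ℕ) (t : ℝ≥0) :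
    MeasurableSet[filtration N X Θ hN hX hΘ t] {ω | n ≤ N t ω} := by
  induction n generalizing t with
  | zero => simp
  | succ n ih =>
    -- The count reaches `n + 1` by time `t` iff `S` still grows after some grid time at which the
    -- count was at least `n`.
    have : {ω | n + 1 ≤ N t ω} = ⋃ s ∈ timeGrid t,
        ({ω | n ≤ N s ω} ∩ {ω | aggregate N X s ω < aggregate N X t ω}) := by
      ext ω
      simp only [Set.mem_ofPred_eq, Set.mem_iUnion, Set.mem_inter_iff, exists_prop]
      constructor
      · intro h
        obtain ⟨s, hs, hsn⟩ := hN.exists_mem_timeGrid (n := n) (by omega : n ≤ N t ω)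
        exact ⟨s, hs, hsn.ge, (aggregate_lt_iff hN hX (le_of_mem_timeGrid hs)).2 (by omega)⟩
      · rintro ⟨s, hs, h1, h2⟩
        have := (aggregate_lt_iff hN hX (le_of_mem_timeGrid hs)).1 h2
        omega
    rw [this]
    refine MeasurableSet.biUnion (countable_timeGrid t) fun s hs => ?_
    have hst := le_of_mem_timeGrid hs
    exact ((filtration N X Θ hN hX hΘ).mono hst _ (ih s)).inter (measurableSet_lt
      (measurable_aggregate_filtration hN hX hΘ hst)
      (measurable_aggregate_filtration hN hX hΘ le_rfl))

theorem measurableSet_count_eq (n : ℕ) {s t : ℝ≥0} (hst : s ≤ t) :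
    MeasurableSet[filtration N X Θ hN hX hΘ t] {ω | N s ω = n} := by
  refine (filtration N X Θ hN hX hΘ).mono hst _ ?_
  have : {ω | N s ω = n} = {ω | n ≤ N s ω} \ {ω | n + 1 ≤ N s ω} := by
    ext ω
    simp only [Set.mem_ofPred_eq, Set.mem_sdiff]
    omega
  rw [this]
  exact (measurableSet_le_count hN hX hΘ n s).diff (measurableSet_le_count hN hX hΘ (n + 1) s)

/-- A size that has occurred by time `t` is the increment of `S` between a grid time of level `k`
and one of level `k + 1`. -/
theorem measurableSet_lt_count_and_size_mem (k : ℕ) (t : ℝ≥0) {B : Set ℝ} (hB : MeasurableSet B) :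
    MeasurableSet[filtration N X Θ hN hX hΘ t] {ω | k < N t ω ∧ X k ω ∈ B} := by
  have : {ω | k < N t ω ∧ X k ω ∈ B} = ⋃ s ∈ timeGrid t, ⋃ u ∈ timeGrid t,
      ({ω | N s ω = k} ∩ {ω | N u ω = k + 1} ∩
        {ω | aggregate N X u ω - aggregate N X s ω ∈ B}) := by
    ext ω
    simp only [Set.mem_ofPred_eq, Set.mem_iUnion, Set.mem_inter_iff, exists_prop]
    constructor
    · rintro ⟨h, hB⟩
      obtain ⟨s, hs, hsn⟩ := hN.exists_mem_timeGrid h.le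
      obtain ⟨u, hu, hun⟩ := hN.exists_mem_timeGrid (n := k + 1) h
      exact ⟨s, hs, u, hu, ⟨hsn, hun⟩, by rwa [aggregate_sub ω hsn hun]⟩
    · rintro ⟨s, hs, u, hu, ⟨hsn, hun⟩, h⟩
      have := hN.mono ω (le_of_mem_timeGrid hu)
      simp only [hun] at this
      rw [aggregate_sub ω hsn hun] at h
      exact ⟨this, h⟩
  rw [this]
  refine MeasurableSet.biUnion (countable_timeGrid t) fun s hs =>
    MeasurableSet.biUnion (countable_timeGrid t) fun u hu => ?_
  have hst := le_of_mem_timeGrid hs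
  have hut := le_of_mem_timeGrid hu
  exact ((measurableSet_count_eq hN hX hΘ _ hst).inter
    (measurableSet_count_eq hN hX hΘ _ hut)).inter
    (((measurable_aggregate_filtration hN hX hΘ hut).sub
      (measurable_aggregate_filtration hN hX hΘ hst)) hB)

theorem measurable_sum_size_filtration {h : ℝ → ℝ} (hh : Measurable h) (t : ℝ≥0) :
    Measurable[filtration N X Θ hN hX hΘ t] fun ω => ∑ k ∈ Finset.range (N t ω), h (X k ω) := by
  -- `X k` alone need not be `F_t`-measurable; cutting it off before its arrival makes it so, and
  -- does not change the sum.
  have hk : ∀ k, Measurable[filtration N X Θ hN hX hΘ t]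
      fun ω => if k < N t ω then h (X k ω) else 0 := by
    intro k B hB
    have : (fun ω => if k < N t ω then h (X k ω) else 0) ⁻¹' B =
        {ω | k < N t ω ∧ X k ω ∈ h ⁻¹' B} ∪ ({ω | k + 1 ≤ N t ω}ᶜ ∩ {_ω | (0 : ℝ) ∈ B}) := by
      ext ω
      simp only [Set.mem_preimage, Set.mem_union, Set.mem_inter_iff, Set.mem_compl_iff,
        Set.mem_ofPred_eq]
      split_ifs with hlt
      · have : k + 1 ≤ N t ω := hlt
        simp [hlt, this]
      · have : ¬ k + 1 ≤ N t ω := hlt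
        simp [hlt, this]
    rw [this]
    exact (measurableSet_lt_count_and_size_mem hN hX hΘ k t (hh hB)).union
      ((measurableSet_le_count hN hX hΘ (k + 1) t).compl.inter (MeasurableSet.const _))
  intro B hB
  have : (fun ω => ∑ k ∈ Finset.range (N t ω), h (X k ω)) ⁻¹' B = ⋃ n, ({ω | N t ω = n} ∩
      (fun ω => ∑ k ∈ Finset.range n, if k < N t ω then h (X k ω) else 0) ⁻¹' B) := by
    ext ω
    simp only [Set.mem_preimage, Set.mem_iUnion, Set.mem_inter_iff, Set.mem_ofPred_eq,
      exists_eq_left']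
    rw [Finset.sum_congr rfl fun k hk => (if_pos (Finset.mem_range.1 hk)).symm]
  rw [this]
  exact MeasurableSet.iUnion fun n => (measurableSet_count_eq hN hX hΘ n le_rfl).inter
    ((Finset.measurable_fun_sum _ fun k _ => hk k) hB)

end Paths

/-- It suffices to compare boxes, where the integral of the product factors by independence of the
coordinates. -/
theorem pi_withDensity {ι : Type*} [Fintype ι] (ν : Measure ℝ) [IsProbabilityMeasure ν]
    {h : ℝ → ℝ≥0∞} (hh : Measurable h) [SigmaFinite (ν.withDensity h)] :
    Measure.pi (fun _ : ι => ν.withDensity h) =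
      (Measure.pi fun _ : ι => ν).withDensity fun x => ∏ i, h (x i) := by
  refine Measure.pi_eq fun s hs => ?_
  rw [withDensity_apply _ (MeasurableSet.univ_pi hs),
    ← lintegral_indicator (MeasurableSet.univ_pi hs)]
  have h1 : ∀ x : ι → ℝ, (Set.univ.pi s).indicator (fun x => ∏ i, h (x i)) x =
      ∏ i, (s i).indicator h (x i) := by
    intro x
    by_cases hx : x ∈ Set.univ.pi s
    · rw [Set.indicator_of_mem hx]
      exact Finset.prod_congr rfl fun i _ => (Set.indicator_of_mem (hx i trivial) _).symm
    · rw [Set.indicator_of_notMem hx]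
      simp only [Set.mem_pi, Set.mem_univ, true_implies, not_forall] at hx
      obtain ⟨i, hi⟩ := hx
      exact (Finset.prod_eq_zero (Finset.mem_univ i) (Set.indicator_of_notMem hi _)).symm
  simp_rw [h1]
  rw [lintegral_prod_eq_prod_lintegral_of_indepFun Finset.univ
    (fun i (x : ι → ℝ) => (s i).indicator h (x i))
    (iIndepFun_pi fun i => (hh.indicator (hs i)).aemeasurable)
    fun i => (hh.indicator (hs i)).comp (measurable_pi_apply i)]
  refine Finset.prod_congr rfl fun i _ => ?_
  rw [withDensity_apply _ (hs i), ← lintegral_indicator (hs i)]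
  exact ((measurePreserving_eval (fun _ : ι => ν) i).lintegral_comp (hh.indicator (hs i)))

/-! ### Poisson models and exponential tilting of the rate -/

section FibreLaw

variable {Ω : Type*}

/-- The increments of `N` along `τ` are given by `d`. -/
def incrementEvent (N : ℝ≥0 → Ω → ℕ) {n : ℕ} (τ : Fin (n + 1) → ℝ≥0) (d : Fin n → ℕ) : Set Ω :=
  {ω | ∀ i, N (τ i.succ) ω - N (τ i.castSucc) ω = d i}

/-- The probability that the increments of a Poisson process with rate `r` along `τ` are `d`. -/
noncomputable def poissonWeight (r : ℝ≥0) {n : ℕ} (τ : Fin (n + 1) → ℝ≥0) (d : Fin n → ℕ) : ℝ≥0∞ :=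
  ∏ i, poissonMeasure ((τ i.succ - τ i.castSucc) * r) {d i}

/-- Under `μ`, `N` is a Poisson process with rate `r`, independent of the sequence `X`, which is
i.i.d. with law `ν`. -/
def IsPoissonModel [MeasurableSpace Ω] (μ : Measure Ω) (N : ℝ≥0 → Ω → ℕ) (X : ℕ → Ω → ℝ) (r : ℝ≥0)
    (ν : Measure ℝ) : Prop :=
  ∀ (n : ℕ) (τ : Fin (n + 1) → ℝ≥0), StrictMono τ → ∀ (d : Fin n → ℕ) (m : ℕ),
    ∀ D : Set (Fin m → ℝ), MeasurableSet D →
      μ (incrementEvent N τ d ∩ (fun ω (j : Fin m) => X j ω) ⁻¹' D) =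
        poissonWeight r τ d * Measure.pi (fun _ : Fin m => ν) D

/-- The likelihood ratio at time `t` of the Poisson model with rate `r e^a` and size law `e^γ ν`
with respect to the one with rate `r` and size law `ν`. -/
noncomputable def likelihood (N : ℝ≥0 → Ω → ℕ) (X : ℕ → Ω → ℝ) (a : ℝ) (γ : ℝ → ℝ) (r t : ℝ≥0)
    (ω : Ω) : ℝ :=
  Real.exp (∑ k ∈ Finset.range (N t ω), (a + γ (X k ω)) - t * r * (Real.exp a - 1))

theorem poissonMeasure_tilt {r r' : ℝ≥0} {a : ℝ} (h : (r' : ℝ) = r * Real.exp a) (u : ℝ≥0) (k : ℕ) :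
    poissonMeasure (u * r') {k} =
      ENNReal.ofReal (Real.exp (a * k - u * r * (Real.exp a - 1))) *
        poissonMeasure (u * r) {k} := by
  rw [poissonMeasure_singleton, poissonMeasure_singleton, ← ENNReal.ofReal_mul (by positivity)]
  congr 1
  push_cast
  rw [h, show a * k - u * r * (Real.exp a - 1) = k * a + u * r + -(u * (r * Real.exp a)) by ring,
    Real.exp_add, Real.exp_add, Real.exp_nat_mul, Real.exp_neg (u * r)]
  field_simp
  ring

/-- The exponents of the one-interval ratios add up: the counts to the total count, and the interval
lengths to the last time, by telescoping from `τ 0 = 0`. -/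
theorem poissonWeight_tilt {r r' : ℝ≥0} {a : ℝ} (h : (r' : ℝ) = r * Real.exp a) {n : ℕ}
    {τ : Fin (n + 1) → ℝ≥0} (hτ : Monotone τ) (h0 : τ 0 = 0) (d : Fin n → ℕ) :
    poissonWeight r' τ d =
      ENNReal.ofReal (Real.exp (a * (∑ i, d i : ℕ) - τ (Fin.last n) * r * (Real.exp a - 1))) *
        poissonWeight r τ d := by
  have htel : (τ (Fin.last n) : ℝ) = ∑ i : Fin n, ((τ i.succ - τ i.castSucc : ℝ≥0) : ℝ) := by
    have h1 : ∀ i : Fin n, ((τ i.succ - τ i.castSucc : ℝ≥0) : ℝ) =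
        (τ i.succ : ℝ) - τ i.castSucc := fun i =>
      NNReal.coe_sub (hτ i.castSucc_lt_succ.le)
    simp_rw [h1]
    have h2 := Fin.sum_univ_succ fun i : Fin (n + 1) => (τ i : ℝ)
    have h3 := Fin.sum_univ_castSucc fun i : Fin (n + 1) => (τ i : ℝ)
    rw [h0] at h2
    rw [Finset.sum_sub_distrib]
    push_cast at h2
    linarith
  unfold poissonWeight
  simp_rw [poissonMeasure_tilt h, Finset.prod_mul_distrib]
  congr 1
  rw [← ENNReal.ofReal_prod_of_nonneg fun i _ => (Real.exp_pos _).le, ← Real.exp_sum]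
  congr 2
  rw [htel, Finset.sum_sub_distrib]
  push_cast
  rw [Finset.mul_sum, Finset.sum_mul, Finset.sum_mul]

end FibreLaw

/-! ### The likelihood ratio of two Poisson models -/

section ChangeOfMeasure

variable {Ω : Type*} [mΩ : MeasurableSpace Ω] {N : ℝ≥0 → Ω → ℕ} {X : ℕ → Ω → ℝ} {Θ : Ω → ℝ}

theorem measurableSet_incrementEvent (hN : IsCountingProcess N) {n : ℕ} (τ : Fin (n + 1) → ℝ≥0)
    (d : Fin n → ℕ) : MeasurableSet (incrementEvent N τ d) := by
  have : incrementEvent N τ d = ⋂ i, (fun ω => N (τ i.succ) ω - N (τ i.castSucc) ω) ⁻¹' {d i} := by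
    ext ω; simp [incrementEvent]
  rw [this]
  exact MeasurableSet.iInter fun i =>
    ((hN.measurable _).sub (hN.measurable _)) (measurableSet_singleton _)

theorem measurable_likelihood (hN : IsCountingProcess N) (hX : IsSizeProcess X) {γ : ℝ → ℝ}
    (hγ : Measurable γ) (a : ℝ) (r t : ℝ≥0) : Measurable (likelihood N X a γ r t) := by
  -- Any filtration serves here; the one of a constant `Θ` is used only to quote the measurability
  -- of the random sum.
  have h := (measurable_sum_size_filtration hN hX (measurable_const (a := (0 : ℝ)))
    (h := fun x => a + γ x) (measurable_const.add hγ) t).mono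
    ((filtration N X _ hN hX measurable_const).le t) le_rfl
  exact Real.measurable_exp.comp (h.sub measurable_const)

/-- The counts along `τ` when the increments are given by `d`. -/
def countOf {n : ℕ} (d : Fin n → ℕ) (i : Fin (n + 1)) : ℕ :=
  ∑ j : Fin n, if j.castSucc < i then d j else 0

theorem count_eq_countOf (hN : IsCountingProcess N) {n : ℕ} {τ : Fin (n + 1) → ℝ≥0}
    (hτ : Monotone τ) (h0 : τ 0 = 0) {d : Fin n → ℕ} {ω : Ω} (h : ω ∈ incrementEvent N τ d)
    (i : Fin (n + 1)) : N (τ i) ω = countOf d i := by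
  induction i using Fin.induction with
  | zero => simp [countOf, h0, hN.zero]
  | succ i ih =>
    have h1 := h i
    -- Monotonicity rules out truncation in the natural subtraction of `h1`.
    have h2 : N (τ i.castSucc) ω ≤ N (τ i.succ) ω := hN.mono ω (hτ i.castSucc_lt_succ.le)
    have h3 : countOf d i.succ = countOf d i.castSucc + d i := by
      unfold countOf
      rw [← Finset.sum_erase_add _ _ (Finset.mem_univ i), ← Finset.sum_erase_add _
        (fun j : Fin n => if j.castSucc < i.castSucc then d j else 0) (Finset.mem_univ i)]
      simp only [Fin.castSucc_lt_succ, if_true, lt_irrefl, if_false, add_zero]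
      congr 1
      refine Finset.sum_congr rfl fun j hj => ?_
      have : j ≠ i := Finset.ne_of_mem_erase hj
      have h4 : j.castSucc < i.succ ↔ j.castSucc < i.castSucc := by
        rw [Fin.lt_def, Fin.lt_def]
        have := Fin.val_ne_of_ne this
        simp
        omega
      simp only [h4]
    omega

theorem countOf_le (n : ℕ) (d : Fin n → ℕ) (i : Fin (n + 1)) : countOf d i ≤ ∑ j, d j :=
  Finset.sum_le_sum fun j _ => by split_ifs <;> simp

theorem countOf_last (n : ℕ) (d : Fin n → ℕ) : countOf d (Fin.last n) = ∑ j, d j :=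
  Finset.sum_congr rfl fun j _ => if_pos (Fin.castSucc_lt_last j)

theorem sum_range_eq_sum_fin {m k : ℕ} (h : k ≤ m) (x : ℕ → ℝ) :
    ∑ j ∈ Finset.range k, x j = ∑ j : Fin m, if (j : ℕ) < k then x j else 0 := by
  rw [Fin.sum_univ_eq_sum_range (fun j => if j < k then x j else 0) m,
    ← Finset.sum_filter]
  congr 1
  ext j
  simp
  omega

/-- On a cell the final count is the constant `m`, so the likelihood is `K * ∏ e^{γ(X_j)}`: the
constant `K` tilts the Poisson weight and the product tilts the law of the first `m` sizes. -/
theorem IsPoissonModel.measure_incrementEvent_inter {μ μ' : Measure Ω} {r r' : ℝ≥0}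
    {ν ν' : Measure ℝ} [IsProbabilityMeasure ν] [IsProbabilityMeasure ν']
    (hN : IsCountingProcess N) (hX : IsSizeProcess X)
    (hμ : IsPoissonModel μ N X r ν) (hμ' : IsPoissonModel μ' N X r' ν')
    {a : ℝ} (hr : (r' : ℝ) = r * Real.exp a) {γ : ℝ → ℝ} (hγ : Measurable γ)
    (hν : ν' = ν.withDensity fun x => ENNReal.ofReal (Real.exp (γ x)))
    {n : ℕ} {τ : Fin (n + 1) → ℝ≥0} (hτ : StrictMono τ) (h0 : τ 0 = 0) (d : Fin n → ℕ)
    {m : ℕ} (hm : ∑ i, d i = m) {D : Set (Fin m → ℝ)} (hD : MeasurableSet D) :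
    μ' (incrementEvent N τ d ∩ (fun ω (j : Fin m) => X j ω) ⁻¹' D) =
      ∫⁻ ω in incrementEvent N τ d ∩ (fun ω (j : Fin m) => X j ω) ⁻¹' D,
        ENNReal.ofReal (likelihood N X a γ r (τ (Fin.last n)) ω) ∂μ := by
  set E := incrementEvent N τ d with hE
  have hEm : MeasurableSet E := measurableSet_incrementEvent hN τ d
  set Y : Ω → Fin m → ℝ := fun ω j => X j ω with hY
  have hYm : Measurable Y := measurable_pi_lambda _ fun j => hX.measurable j
  set h : ℝ → ℝ≥0∞ := fun x => ENNReal.ofReal (Real.exp (γ x)) with hh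
  have hhm : Measurable h := (Real.measurable_exp.comp hγ).ennreal_ofReal
  set K : ℝ≥0∞ := ENNReal.ofReal (Real.exp (a * (m : ℕ) - τ (Fin.last n) * r * (Real.exp a - 1)))
    with hK
  have hlaw : (μ.restrict E).map Y = poissonWeight r τ d • Measure.pi (fun _ : Fin m => ν) := by
    ext D hD
    rw [Measure.map_apply hYm hD, Measure.restrict_apply (hYm hD), Set.inter_comm,
      hμ n τ hτ d m D hD, Measure.smul_apply, smul_eq_mul]
  have hlik : ∀ ω ∈ E ∩ Y ⁻¹' D, ENNReal.ofReal (likelihood N X a γ r (τ (Fin.last n)) ω) =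
      K * ∏ j, h (Y ω j) := by
    intro ω hω
    have hcount := count_eq_countOf hN hτ.monotone h0 hω.1 (Fin.last n)
    rw [countOf_last, hm] at hcount
    rw [hK, ← ENNReal.ofReal_prod_of_nonneg (fun j _ => (Real.exp_pos _).le),
      ← ENNReal.ofReal_mul (Real.exp_pos _).le, ← Real.exp_sum, ← Real.exp_add]
    congr 2
    rw [likelihood, hcount, Finset.sum_add_distrib]
    congr 1
    simp only [Finset.sum_const, Finset.card_range, nsmul_eq_mul, hY]
    rw [Fin.sum_univ_eq_sum_range (fun j => γ (X j ω)) m]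
    ring
  have hpim : Measurable fun x : Fin m → ℝ => ∏ j, h (x j) :=
    Finset.measurable_fun_prod _ fun j _ => hhm.comp (measurable_pi_apply j)
  have : SigmaFinite (ν.withDensity h) := hν ▸ inferInstance
  calc μ' (E ∩ Y ⁻¹' D) = poissonWeight r' τ d * Measure.pi (fun _ : Fin m => ν') D :=
        hμ' n τ hτ d m D hD
    _ = K * (poissonWeight r τ d * ∫⁻ x in D, ∏ j, h (x j) ∂Measure.pi fun _ : Fin m => ν) := by
        rw [poissonWeight_tilt hr hτ.monotone h0, hν, pi_withDensity ν hhm,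
          withDensity_apply _ hD, mul_assoc, hm]
    _ = K * ∫⁻ ω in Y ⁻¹' D, ∏ j, h (Y ω j) ∂(μ.restrict E) := by
        rw [← setLIntegral_map hD hpim hYm, hlaw, Measure.restrict_smul, lintegral_smul_measure,
          smul_eq_mul]
    _ = ∫⁻ ω in E ∩ Y ⁻¹' D, K * ∏ j, h (Y ω j) ∂μ := by
        rw [← lintegral_const_mul K (f := fun ω => ∏ j, h (Y ω j)) (hpim.comp hYm),
          Measure.restrict_restrict (hYm hD),
          Set.inter_comm]
    _ = _ := (setLIntegral_congr_fun (hEm.inter (hYm hD)) hlik).symm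

/-- Both sides are finite measures, so they need only agree on the π-system of events fixing
finitely many values of `S`. Such an event splits into countably many cells, one for each vector of
increments. -/
theorem IsPoissonModel.measure_eq_setLIntegral_aggregate {μ μ' : Measure Ω}
    [IsProbabilityMeasure μ'] {r r' : ℝ≥0} {ν ν' : Measure ℝ}
    [IsProbabilityMeasure ν] [IsProbabilityMeasure ν']
    (hN : IsCountingProcess N) (hX : IsSizeProcess X)
    (hμ : IsPoissonModel μ N X r ν) (hμ' : IsPoissonModel μ' N X r' ν')
    {a : ℝ} (hr : (r' : ℝ) = r * Real.exp a) {γ : ℝ → ℝ} (hγ : Measurable γ)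
    (hν : ν' = ν.withDensity fun x => ENNReal.ofReal (Real.exp (γ x))) (t : ℝ≥0) {A : Set Ω}
    (hA : MeasurableSet[⨆ u ∈ Set.Iic t, MeasurableSpace.comap (aggregate N X u) inferInstance] A) :
    μ' A = ∫⁻ ω in A, ENNReal.ofReal (likelihood N X a γ r t ω) ∂μ := by
  classical
  have hle : ∀ u, MeasurableSpace.comap (aggregate N X u) inferInstance ≤ mΩ := fun u =>
    (measurable_aggregate hN hX u).comap_le
  have key : ∀ (I : Finset ℝ≥0) (B : ℝ≥0 → Set ℝ), (↑I ⊆ Set.Iic t) → 0 ∈ I → t ∈ I →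
      (∀ s, MeasurableSet (B s)) →
      μ' (⋂ s ∈ I, aggregate N X s ⁻¹' B s) =
        ∫⁻ ω in ⋂ s ∈ I, aggregate N X s ⁻¹' B s,
          ENNReal.ofReal (likelihood N X a γ r t ω) ∂μ := by
    intro I B hI h0 ht hB
    obtain ⟨n, hn⟩ : ∃ n, I.card = n + 1 :=
      Nat.exists_eq_succ_of_ne_zero (Finset.card_ne_zero_of_mem h0)
    set τ := I.orderEmbOfFin hn with hτ
    have hmono : StrictMono τ := (I.orderEmbOfFin hn).strictMono
    have hmem : ∀ s, s ∈ I ↔ ∃ i, τ i = s := fun s => by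
      rw [← Finset.mem_coe, ← Finset.range_orderEmbOfFin I hn]; rfl
    have hτ0 : τ 0 = 0 := by
      obtain ⟨i, hi⟩ := (hmem 0).1 h0
      exact le_antisymm (hi ▸ hmono.monotone (Fin.zero_le i)) zero_le
    have hτt : τ (Fin.last n) = t := by
      obtain ⟨i, hi⟩ := (hmem t).1 ht
      exact le_antisymm (hI ((hmem _).2 ⟨_, rfl⟩)) (hi ▸ hmono.monotone (Fin.le_last i))
    set G := ⋂ s ∈ I, aggregate N X s ⁻¹' B s with hG
    have hGm : MeasurableSet G :=
      Finset.measurableSet_biInter _ fun s _ => measurable_aggregate hN hX s (hB s)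
    have hGmem : ∀ ω, ω ∈ G ↔ ∀ i, aggregate N X (τ i) ω ∈ B (τ i) := by
      intro ω
      simp only [hG, Set.mem_iInter, Set.mem_preimage, hmem]
      exact ⟨fun h i => h _ ⟨i, rfl⟩, by rintro h _ ⟨i, rfl⟩; exact h i⟩
    -- Once the increments are `d`, the values of `S` along `τ` are partial sums of the first `∑ d
    -- i` sizes, so the event becomes a condition `D d` on these sizes.
    let D : ∀ d : Fin n → ℕ, Set (Fin (∑ i, d i) → ℝ) := fun d =>
      ⋂ i, (fun x => ∑ j : Fin (∑ i, d i), if (j : ℕ) < countOf d i then x j else 0) ⁻¹' B (τ i)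
    have hDm : ∀ d, MeasurableSet (D d) := fun d => MeasurableSet.iInter fun i =>
      (Finset.measurable_fun_sum _ fun j _ => by
        split_ifs
        exacts [measurable_pi_apply j, measurable_const]) (hB _)
    have hcell : ∀ d, G ∩ incrementEvent N τ d =
        incrementEvent N τ d ∩ (fun ω (j : Fin (∑ i, d i)) => X j ω) ⁻¹' D d := by
      intro d
      ext ω
      rw [Set.inter_comm, Set.mem_inter_iff, Set.mem_inter_iff, hGmem]
      refine and_congr_right fun hω => ?_
      simp only [D, Set.preimage_iInter, Set.mem_iInter, Set.mem_preimage]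
      refine forall_congr' fun i => ?_
      rw [aggregate, count_eq_countOf hN hmono.monotone hτ0 hω i,
        sum_range_eq_sum_fin (countOf_le n d i) fun j => X j ω]
    have hunion : G = ⋃ d : Fin n → ℕ, G ∩ incrementEvent N τ d := by
      rw [← Set.inter_iUnion, Set.inter_eq_left.2]
      exact fun ω _ => Set.mem_iUnion.2 ⟨_, fun i => rfl⟩
    have hdisj : Pairwise (Function.onFun Disjoint fun d : Fin n → ℕ =>
        G ∩ incrementEvent N τ d) := by
      intro d d' hdd
      refine Set.disjoint_left.2 fun ω h h' => hdd ?_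
      ext i
      exact (h.2 i).symm.trans (h'.2 i)
    have hmeas : ∀ d : Fin n → ℕ, MeasurableSet (G ∩ incrementEvent N τ d) := fun d =>
      hGm.inter (measurableSet_incrementEvent hN τ d)
    rw [hunion, measure_iUnion hdisj hmeas, lintegral_iUnion hmeas hdisj]
    refine tsum_congr fun d => ?_
    rw [hcell, IsPoissonModel.measure_incrementEvent_inter hN hX hμ hμ' hr hγ hν hmono hτ0 d
      rfl (hDm d), hτt]
  have hlm := (measurable_likelihood hN hX hγ a r t).ennreal_ofReal
  set L := μ.withDensity fun ω => ENNReal.ofReal (likelihood N X a γ r t ω) with hL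
  have hsub : ↑({0, t} : Finset ℝ≥0) ⊆ Set.Iic t := by
    intro s hs
    simp only [Finset.coe_insert, Finset.coe_singleton, Set.mem_insert_iff,
      Set.mem_singleton_iff] at hs
    rcases hs with rfl | rfl <;> simp
  have hAm : MeasurableSet A := (iSup₂_le fun u _ => hle u : _ ≤ mΩ) _ hA
  rw [← withDensity_apply _ hAm]
  refine ext_on_measurableSpace_of_generate_finite mΩ _ ?_ (iSup₂_le fun u _ => hle u)
    (generateFrom_piiUnionInter_measurableSet
      (fun u => MeasurableSpace.comap (aggregate N X u) inferInstance) (Set.Iic t)).symm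
    (isPiSystem_piiUnionInter _ (fun u => @MeasurableSpace.isPiSystem_measurableSet Ω
      (MeasurableSpace.comap (aggregate N X u) inferInstance)) _) ?_ hA
  · rintro _ ⟨I, hI, f, hf, rfl⟩
    choose! B hBm hB using hf
    -- The times 0 and `t` are adjoined, with no constraint if they are new: increments then
    -- determine counts, and the last count is the one in the likelihood.
    let B' : ℝ≥0 → Set ℝ := fun s => if s ∈ I then B s else Set.univ
    have hB' : ∀ s, MeasurableSet (B' s) := fun s => by
      simp only [B']
      split_ifs with h
      exacts [hBm s h, MeasurableSet.univ]
    have heq : ⋂ s ∈ I, f s = ⋂ s ∈ I ∪ {0, t}, aggregate N X s ⁻¹' B' s := by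
      ext ω
      simp only [Set.mem_iInter, Set.mem_preimage, B']
      constructor
      · intro h s _
        by_cases hs : s ∈ I
        · have := h s hs
          rw [← hB s hs] at this
          simpa [hs] using this
        · simp [hs]
      · intro h s hs
        have := h s (Finset.mem_union_left _ hs)
        rw [if_pos hs] at this
        rw [← hB s hs]
        exact this
    have hm : MeasurableSet (⋂ s ∈ I ∪ {0, t}, aggregate N X s ⁻¹' B' s) :=
      Finset.measurableSet_biInter _ fun s _ => measurable_aggregate hN hX s (hB' s)
    rw [heq, withDensity_apply _ hm]
    refine key _ _ ?_ (by simp) (by simp) hB'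
    rw [Finset.coe_union]
    exact Set.union_subset hI hsub
  · have := key {0, t} (fun _ => Set.univ) hsub (by simp) (by simp) fun _ => MeasurableSet.univ
    simp only [Set.preimage_univ, Set.iInter_univ] at this
    rw [withDensity_apply _ MeasurableSet.univ, this]

/-- On the fibre `Θ = θ` the variable `Θ` is constant, so `σ(Θ)` has trivial trace and adds nothing
to the σ-algebra of `S`. -/
theorem exists_measurableSet_aggregate_inter (hN : IsCountingProcess N) (hX : IsSizeProcess X)
    (hΘ : Measurable Θ) (t : ℝ≥0) (θ : ℝ) {A : Set Ω}
    (hA : MeasurableSet[filtration N X Θ hN hX hΘ t] A) :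
    ∃ A', MeasurableSet[⨆ u ∈ Set.Iic t, MeasurableSpace.comap (aggregate N X u) inferInstance] A' ∧
      ∀ ω, Θ ω = θ → (ω ∈ A ↔ ω ∈ A') := by
  set H : MeasurableSpace Ω :=
    ⨆ u ∈ Set.Iic t, MeasurableSpace.comap (aggregate N X u) inferInstance with hH
  let v : {ω // Θ ω = θ} → Ω := Subtype.val
  have h1 : MeasurableSpace.comap v (H ⊔ MeasurableSpace.comap Θ inferInstance) =
      MeasurableSpace.comap v H := by
    have : Θ ∘ v = fun _ => θ := funext fun ω => ω.2
    rw [MeasurableSpace.comap_sup, MeasurableSpace.comap_comp, this, MeasurableSpace.comap_const,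
      sup_bot_eq]
  have h2 : MeasurableSet[MeasurableSpace.comap v (H ⊔ MeasurableSpace.comap Θ inferInstance)]
      (v ⁻¹' A) := ⟨A, hA, rfl⟩
  rw [h1] at h2
  obtain ⟨A', hA', he⟩ := h2
  exact ⟨A', hA', fun ω hω => (Set.ext_iff.1 he ⟨ω, hω⟩).symm⟩

theorem IsPoissonModel.measure_eq_setLIntegral {μ μ' : Measure Ω}
    [IsProbabilityMeasure μ'] {r r' : ℝ≥0} {ν ν' : Measure ℝ}
    [IsProbabilityMeasure ν] [IsProbabilityMeasure ν']
    (hN : IsCountingProcess N) (hX : IsSizeProcess X) (hΘ : Measurable Θ)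
    (hμ : IsPoissonModel μ N X r ν) (hμ' : IsPoissonModel μ' N X r' ν') {θ : ℝ}
    (hθ : ∀ᵐ ω ∂μ, Θ ω = θ) (hθ' : ∀ᵐ ω ∂μ', Θ ω = θ)
    {a : ℝ} (hr : (r' : ℝ) = r * Real.exp a) {γ : ℝ → ℝ} (hγ : Measurable γ)
    (hν : ν' = ν.withDensity fun x => ENNReal.ofReal (Real.exp (γ x))) (t : ℝ≥0) {A : Set Ω}
    (hA : MeasurableSet[filtration N X Θ hN hX hΘ t] A) :
    μ' A = ∫⁻ ω in A, ENNReal.ofReal (likelihood N X a γ r t ω) ∂μ := by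
  obtain ⟨A', hA', h⟩ := exists_measurableSet_aggregate_inter hN hX hΘ t θ hA
  have h1 : A =ᵐ[μ] A' := Filter.eventuallyEq_set.2 (hθ.mono fun ω hω => h ω hω)
  have h2 : A =ᵐ[μ'] A' := Filter.eventuallyEq_set.2 (hθ'.mono fun ω hω => h ω hω)
  rw [measure_congr h2, setLIntegral_congr h1]
  exact hμ.measure_eq_setLIntegral_aggregate hN hX hμ' hr hγ hν t hA'

end ChangeOfMeasure

/-! ### Counts as functions of the interarrival times -/

section Arrival

variable {Ω : Type*} [mΩ : MeasurableSpace Ω] {N : ℝ≥0 → Ω → ℕ}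

/-- Level `n` is reached because jumps have size at most one and the path is unbounded; right
continuity makes the infimum attained. -/
theorem IsCountingProcess.count_arrival (hN : IsCountingProcess N) (n : ℕ) (ω : Ω) :
    N (arrival N n ω) ω = n := by
  obtain ⟨T, hT⟩ := hN.unbounded ω n
  obtain ⟨s, -, hs⟩ := hN.exists_mem_timeGrid hT
  have hne : {t | N t ω = n}.Nonempty := ⟨s, hs⟩
  obtain ⟨u, hu, hu'⟩ := hN.right_cont ω (arrival N n ω)
  obtain ⟨v, hv, hvu⟩ := exists_lt_of_csInf_lt hne hu
  have h1 : N (arrival N n ω) ω ≤ N v ω := hN.mono ω (csInf_le' hv)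
  have h2 : N v ω ≤ N u ω := hN.mono ω hvu.le
  have h3 : N v ω = n := hv
  omega

theorem IsCountingProcess.le_count_iff (hN : IsCountingProcess N) {n : ℕ} {t : ℝ≥0} {ω : Ω} :
    n ≤ N t ω ↔ arrival N n ω ≤ t := by
  constructor
  · intro h
    obtain ⟨s, hs, hsn⟩ := hN.exists_mem_timeGrid h
    exact le_trans (csInf_le' hsn) (le_of_mem_timeGrid hs)
  · intro h
    have := hN.mono ω h
    simpa only [hN.count_arrival] using this

theorem IsCountingProcess.arrival_eq_sum (hN : IsCountingProcess N) (n : ℕ) (ω : Ω) :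
    (arrival N n ω : ℝ) = ∑ k ∈ Finset.range n, interarrival N k ω := by
  have h0 : arrival N 0 ω = 0 := le_antisymm (csInf_le' (hN.zero ω)) zero_le
  simp only [interarrival]
  rw [Finset.sum_range_sub (fun k => (arrival N k ω : ℝ)), h0]
  simp

theorem IsCountingProcess.measurable_comap_interarrival (hN : IsCountingProcess N) (t : ℝ≥0) :
    Measurable[MeasurableSpace.comap (fun ω n => interarrival N n ω) inferInstance] (N t) := by
  refine measurable_of_Ici fun n => ?_
  have hm : MeasurableSet {w : ℕ → ℝ | ∑ k ∈ Finset.range n, w k ≤ t} :=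
    measurableSet_le (Finset.measurable_fun_sum _ fun k _ => measurable_pi_apply k)
      measurable_const
  refine ⟨_, hm, ?_⟩
  ext ω
  simp only [Set.mem_preimage, Set.mem_ofPred_eq, Set.mem_Ici, ← hN.arrival_eq_sum,
    hN.le_count_iff, NNReal.coe_le_coe]

/-- Condition (a1) speaks of interarrival times; this brings increment events within its reach,
through `N_t ≥ n ↔ T_n ≤ t`. -/
theorem exists_interarrival_preimage (hN : IsCountingProcess N) {n : ℕ} (τ : Fin (n + 1) → ℝ≥0)
    (d : Fin n → ℕ) : ∃ A, MeasurableSet A ∧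
      (fun ω n => interarrival N n ω) ⁻¹' A = incrementEvent N τ d := by
  have h : MeasurableSet[MeasurableSpace.comap (fun ω n => interarrival N n ω) inferInstance]
      (⋂ i, (fun ω => N (τ i.succ) ω - N (τ i.castSucc) ω) ⁻¹' {d i}) :=
    MeasurableSet.iInter fun i =>
      ((hN.measurable_comap_interarrival _).sub (hN.measurable_comap_interarrival _))
        (measurableSet_singleton _)
  obtain ⟨A, hA, he⟩ := h
  refine ⟨A, hA, he.trans ?_⟩
  ext ω
  simp [incrementEvent]

end Arrival

/-! ### The fibre measures are Poisson models -/

section Conditional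

variable {Ω : Type*} [mΩ : MeasurableSpace Ω] {N : ℝ≥0 → Ω → ℕ} {X : ℕ → Ω → ℝ} {Θ : Ω → ℝ}
  {μ : Measure Ω}

theorem IsMPP.condProb_increment {g : ℝ → ℝ} (hN : IsCountingProcess N) (h : IsMPP μ N Θ g)
    {s t : ℝ≥0} (hst : s < t) (B : Set ℕ) :
    condProb μ Θ {ω | N t ω - N s ω ∈ B} =ᵐ[μ]
      fun ω => (poissonMeasure ((t - s) * (g (Θ ω)).toNNReal)).real B := by
  have h1 := h.stat_incr 0 (t - s) s (tsub_pos_of_lt hst) B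
  simp only [tsub_add_cancel_of_le hst.le, zero_add, hN.zero, tsub_zero] at h1
  exact h1.trans (h.poisson (t - s) (tsub_pos_of_lt hst) B)

/-- The exceptional set in the consistency condition depends on `B`; countably many rational
half-lines suffice to pin down the value of `Θ`. -/
theorem IsConsistentRCP.ae_ae_eq {κ : Kernel ℝ Ω} (h : IsConsistentRCP κ μ Θ) (hΘ : Measurable Θ) :
    ∀ᵐ θ ∂μ.map Θ, ∀ᵐ ω ∂κ θ, Θ ω = θ := by
  have h1 : ∀ᵐ θ ∂μ.map Θ, ∀ q : ℚ, θ ∈ Set.Iio (q : ℝ) → κ θ (Θ ⁻¹' Set.Iio (q : ℝ)) = 1 :=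
    ae_all_iff.2 fun q => h.consistent _ measurableSet_Iio
  have h2 : ∀ᵐ θ ∂μ.map Θ, ∀ q : ℚ, θ ∈ Set.Ici (q : ℝ) → κ θ (Θ ⁻¹' Set.Ici (q : ℝ)) = 1 :=
    ae_all_iff.2 fun q => h.consistent _ measurableSet_Ici
  filter_upwards [h1, h2] with θ h1 h2
  have := h.prob θ
  have h3 : ∀ᵐ ω ∂κ θ, ∀ q : ℚ, θ < q ↔ Θ ω < q := by
    refine ae_all_iff.2 fun q => ?_
    rcases lt_or_ge θ (q : ℝ) with hq | hq
    · filter_upwards [(mem_ae_iff_prob_eq_one (hΘ measurableSet_Iio)).2 (h1 q hq)] with ω hω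
      exact iff_of_true hq hω
    · filter_upwards [(mem_ae_iff_prob_eq_one (hΘ measurableSet_Ici)).2 (h2 q hq)] with ω hω
      exact iff_of_false hq.not_gt (not_lt.2 hω)
  exact h3.mono fun ω hω => (eq_of_forall_lt_rat_iff_lt hω).symm

theorem IsConsistentRCP.setLIntegral {κ : Kernel ℝ Ω} (h : IsConsistentRCP κ μ Θ)
    (hΘ : Measurable Θ) {A : Set Ω} (hA : MeasurableSet A) {B : Set ℝ} (hB : MeasurableSet B) :
    ∫⁻ θ in B, κ θ A ∂μ.map Θ = μ (A ∩ Θ ⁻¹' B) := by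
  rw [← h.disint _ (hA.inter (hΘ hB)), ← lintegral_indicator hB]
  refine lintegral_congr_ae ?_
  filter_upwards [h.ae_ae_eq hΘ] with θ hθ
  by_cases hB : θ ∈ B
  · rw [Set.indicator_of_mem hB]
    refine measure_congr (Filter.eventuallyEq_set.2 (hθ.mono fun ω hω => ?_))
    simp [hω, hB]
  · rw [Set.indicator_of_notMem hB]
    refine (measure_eq_zero_iff_ae_notMem.2 (hθ.mono fun ω hω => ?_)).symm
    simp [hω, hB]

variable [IsProbabilityMeasure μ]

theorem setIntegral_condProb (hΘ : Measurable Θ) {A : Set Ω} (hA : MeasurableSet A) {B : Set ℝ}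
    (hB : MeasurableSet B) : ∫ ω in Θ ⁻¹' B, condProb μ Θ A ω ∂μ = μ.real (A ∩ Θ ⁻¹' B) := by
  rw [condProb, setIntegral_condExp hΘ.comap_le ((integrable_const 1).indicator hA) ⟨B, hB, rfl⟩,
    integral_indicator_const _ hA]
  simp [hA, measureReal_restrict_apply]

theorem condProb_preimage_size (hX : IsSizeProcess X) (hΘ : Measurable Θ) (h2 : CondA2 μ X Θ)
    {D : Set (ℕ → ℝ)} (hD : MeasurableSet D) :
    condProb μ Θ ((fun ω n => X n ω) ⁻¹' D) =ᵐ[μ] fun _ => μ.real ((fun ω n => X n ω) ⁻¹' D) := by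
  have hXm : Measurable fun ω n => X n ω := measurable_pi_lambda _ hX.measurable
  have hm : MeasurableSet[MeasurableSpace.comap (fun ω n => X n ω) inferInstance]
      ((fun ω n => X n ω) ⁻¹' D) := ⟨D, hD, rfl⟩
  have h := condExp_indep_eq hXm.comap_le hΘ.comap_le (μ := μ)
    ((stronglyMeasurable_const (b := (1 : ℝ))).indicator hm) h2.symm
  refine h.trans (Filter.Eventually.of_forall fun _ => ?_)
  simp only [integral_indicator_const (1 : ℝ) (hXm hD), smul_eq_mul, mul_one]

/-- By (a1) the conditional probability given `Θ` factors; by (a2) the factor of the sizes is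
constant and leaves the integral over `Θ ⁻¹' B`. -/
theorem measure_increment_size_inter (hN : IsCountingProcess N) (hX : IsSizeProcess X)
    (hΘ : Measurable Θ) (h1 : CondA1 μ N X Θ) (h2 : CondA2 μ X Θ) {n : ℕ}
    (τ : Fin (n + 1) → ℝ≥0) (d : Fin n → ℕ) {D : Set (ℕ → ℝ)} (hD : MeasurableSet D) {B : Set ℝ}
    (hB : MeasurableSet B) :
    μ (incrementEvent N τ d ∩ (fun ω n => X n ω) ⁻¹' D ∩ Θ ⁻¹' B) =
      μ (incrementEvent N τ d ∩ Θ ⁻¹' B) * μ ((fun ω n => X n ω) ⁻¹' D) := by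
  have hXm : Measurable fun ω n => X n ω := measurable_pi_lambda _ hX.measurable
  have hE : MeasurableSet (incrementEvent N τ d) := measurableSet_incrementEvent hN τ d
  obtain ⟨A, hA, he⟩ := exists_interarrival_preimage hN τ d
  have h := h1 A D hA hD
  rw [he] at h
  rw [← ENNReal.toReal_eq_toReal_iff' (by finiteness) (by finiteness), ENNReal.toReal_mul]
  change μ.real _ = μ.real _ * μ.real _
  rw [← setIntegral_condProb hΘ (hE.inter (hXm hD)) hB, ← setIntegral_condProb hΘ hE hB,
    ← integral_mul_const]
  refine integral_congr_ae (ae_restrict_of_ae ?_)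
  filter_upwards [h, condProb_preimage_size hX hΘ h2 hD] with ω hω hω'
  rw [hω, hω']

theorem poissonWeight_le_one (r : ℝ≥0) {n : ℕ} (τ : Fin (n + 1) → ℝ≥0) (d : Fin n → ℕ) :
    poissonWeight r τ d ≤ 1 :=
  Finset.prod_le_one' fun _ _ => prob_le_one

theorem continuous_poissonMeasure (k : ℕ) :
    Continuous fun r : ℝ≥0 => poissonMeasure r {k} := by
  simp_rw [poissonMeasure_singleton]
  exact ENNReal.continuous_ofReal.comp (by fun_prop)

theorem measurable_poissonWeight {n : ℕ} (τ : Fin (n + 1) → ℝ≥0) (d : Fin n → ℕ) :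
    Measurable fun r => poissonWeight r τ d :=
  Finset.measurable_fun_prod _ fun i _ =>
    ((continuous_poissonMeasure (d i)).comp (continuous_const.mul continuous_id)).measurable

theorem IsMPP.measure_incrementEvent_inter {g : ℝ → ℝ} (hN : IsCountingProcess N)
    (hΘ : Measurable Θ) (hg : Measurable g) (h : IsMPP μ N Θ g) {n : ℕ} {τ : Fin (n + 1) → ℝ≥0}
    (hτ : StrictMono τ) (d : Fin n → ℕ) {B : Set ℝ} (hB : MeasurableSet B) :
    μ (incrementEvent N τ d ∩ Θ ⁻¹' B) =
      ∫⁻ θ in B, poissonWeight (g θ).toNNReal τ d ∂μ.map Θ := by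
  have hE : MeasurableSet (incrementEvent N τ d) := measurableSet_incrementEvent hN τ d
  have hw : Measurable fun θ => poissonWeight (g θ).toNNReal τ d :=
    (measurable_poissonWeight τ d).comp hg.real_toNNReal
  have hfin : ∫⁻ θ in B, poissonWeight (g θ).toNNReal τ d ∂μ.map Θ ≠ ∞ := by
    have := Measure.isProbabilityMeasure_map (μ := μ) hΘ.aemeasurable
    refine ((lintegral_mono fun θ => poissonWeight_le_one _ τ d).trans_lt ?_).ne
    simp
  rw [← ENNReal.toReal_eq_toReal_iff' (by finiteness) hfin]
  change μ.real _ = _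
  rw [← setIntegral_condProb hΘ hE hB, setLIntegral_map hB hw hΘ,
    ← integral_toReal (f := fun ω => poissonWeight (g (Θ ω)).toNNReal τ d)
      (hw.comp hΘ).aemeasurable
      (Filter.Eventually.of_forall fun ω =>
        (poissonWeight_le_one _ τ d).trans_lt ENNReal.one_lt_top)]
  refine integral_congr_ae (ae_restrict_of_ae ?_)
  have h1 := h.indep_incr n τ hτ fun i => {d i}
  have h2 : ∀ᵐ ω ∂μ, ∀ i,
      condProb μ Θ {ω | N (τ i.succ) ω - N (τ i.castSucc) ω ∈ ({d i} : Set ℕ)} ω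
      = (poissonMeasure ((τ i.succ - τ i.castSucc) * (g (Θ ω)).toNNReal)).real {d i} :=
    ae_all_iff.2 fun i => h.condProb_increment hN (hτ i.castSucc_lt_succ) {d i}
  have he : ⋂ i, {ω | N (τ i.succ) ω - N (τ i.castSucc) ω ∈ ({d i} : Set ℕ)} =
      incrementEvent N τ d := by
    ext ω
    simp [incrementEvent]
  rw [he] at h1
  filter_upwards [h1, h2] with ω hω hω'
  rw [hω, Finset.prod_congr rfl fun i _ => hω' i]
  exact (ENNReal.toReal_prod _ _).symm

theorem map_size_eq_pi (hX : IsSizeProcess X) (h : IsRiskProcess μ N X) (m : ℕ) :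
    μ.map (fun ω (j : Fin m) => X j ω) = Measure.pi fun _ => μ.map (X 0) := by
  rw [(iIndepFun_iff_map_fun_eq_pi_map fun j : Fin m => (hX.measurable j).aemeasurable).1
    (h.indep.precomp Fin.val_injective)]
  congr 1
  funext j
  exact (h.ident j).map_eq

/-- Only the integrals over sets `Θ ∈ B` are known. They say that two finite kernels have the same
composition product with the law of `Θ`; uniqueness of disintegration makes the kernels equal almost
everywhere, with one null set for all `D`. -/
theorem ae_incrementEvent_inter {g : ℝ → ℝ} {κ : Kernel ℝ Ω} (hN : IsCountingProcess N)
    (hX : IsSizeProcess X) (hΘ : Measurable Θ) (h1 : CondA1 μ N X Θ) (h2 : CondA2 μ X Θ)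
    (hS : IsCMPP μ N X Θ g) (hκ : IsConsistentRCP κ μ Θ) (hg : Measurable g) {n : ℕ}
    {τ : Fin (n + 1) → ℝ≥0} (hτ : StrictMono τ) (d : Fin n → ℕ) (m : ℕ) :
    ∀ᵐ θ ∂μ.map Θ, ∀ D : Set (Fin m → ℝ), MeasurableSet D →
      κ θ (incrementEvent N τ d ∩ (fun ω (j : Fin m) => X j ω) ⁻¹' D) =
        poissonWeight (g θ).toNNReal τ d * Measure.pi (fun _ : Fin m => μ.map (X 0)) D := by
  have := Measure.isProbabilityMeasure_map (μ := μ) hΘ.aemeasurable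
  have := Measure.isProbabilityMeasure_map (μ := μ) (hX.measurable 0).aemeasurable
  have : IsMarkovKernel κ := ⟨hκ.prob⟩
  set ρ : Measure (Fin m → ℝ) := Measure.pi fun _ : Fin m => μ.map (X 0) with hρ
  have hE : MeasurableSet (incrementEvent N τ d) := measurableSet_incrementEvent hN τ d
  have hXm : Measurable fun ω n => X n ω := measurable_pi_lambda _ hX.measurable
  have hYm : Measurable fun ω (j : Fin m) => X j ω :=
    measurable_pi_lambda _ fun j => hX.measurable j
  have hw : Measurable fun θ => poissonWeight (g θ).toNNReal τ d :=
    (measurable_poissonWeight τ d).comp hg.real_toNNReal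
  have hwu : Measurable (Function.uncurry fun (θ : ℝ) (_ : Fin m → ℝ) =>
      poissonWeight (g θ).toNNReal τ d) := hw.comp measurable_fst
  let η : Kernel ℝ (Fin m → ℝ) :=
    (Kernel.const ℝ ρ).withDensity fun θ _ => poissonWeight (g θ).toNNReal τ d
  have : IsFiniteKernel η := Kernel.isFiniteKernel_withDensity_of_bounded _ ENNReal.one_ne_top
    fun θ _ => poissonWeight_le_one _ τ d
  have hη : ∀ θ D, η θ D = poissonWeight (g θ).toNNReal τ d * ρ D := fun θ D => by
    simp [η, Kernel.withDensity_apply' _ hwu]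
  let κ' : Kernel ℝ (Fin m → ℝ) := (κ.restrict hE).map fun ω (j : Fin m) => X j ω
  have hκ' : ∀ θ D, MeasurableSet D → κ' θ D =
      κ θ (incrementEvent N τ d ∩ (fun ω (j : Fin m) => X j ω) ⁻¹' D) := fun θ D hD => by
    rw [Kernel.map_apply' _ hYm _ hD, Kernel.restrict_apply' _ hE _ (hYm hD), Set.inter_comm]
  have heq : μ.map Θ ⊗ₘ κ' = μ.map Θ ⊗ₘ η := by
    refine Measure.ext_prod fun {B D} hB hD => ?_
    rw [Measure.compProd_apply_prod hB hD, Measure.compProd_apply_prod hB hD]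
    simp_rw [hη, hκ' _ D hD]
    rw [hκ.setLIntegral hΘ (hE.inter (hYm hD)) hB, lintegral_mul_const _ hw,
      ← hS.mpp.measure_incrementEvent_inter hN hΘ hg hτ d hB]
    have hr : Measurable fun (x : ℕ → ℝ) (j : Fin m) => x j :=
      measurable_pi_lambda _ fun j => measurable_pi_apply _
    have := measure_increment_size_inter hN hX hΘ h1 h2 τ d (hr hD) hB
    rw [hρ, ← map_size_eq_pi hX hS.risk m, Measure.map_apply hYm hD]
    exact this
  filter_upwards [Kernel.ae_eq_of_compProd_eq heq] with θ hθ D hD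
  rw [← hκ' θ D hD, ← hη θ D, hθ]

theorem exists_denseSeq_gt (x : ℝ≥0) (j : ℕ) : ∃ k, x < TopologicalSpace.denseSeq ℝ≥0 k ∧
    TopologicalSpace.denseSeq ℝ≥0 k < x + 1 / (j + 1) := by
  obtain ⟨k, h1, h2⟩ := (TopologicalSpace.denseRange_denseSeq ℝ≥0).exists_mem_open isOpen_Ioo
    (Set.nonempty_Ioo.2 (lt_add_of_pos_right x (by positivity : (0 : ℝ≥0) < 1 / (j + 1))))
  exact ⟨k, h1, h2⟩

/-- Arbitrary times are approximated from the right by the dense sequence. By right continuity the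
counts are eventually equal to their limits, and Poisson weights are continuous in the times. -/
theorem isPoissonModel_of_denseSeq {κ : Measure Ω} [IsProbabilityMeasure κ]
    (hN : IsCountingProcess N) (hX : IsSizeProcess X) (r : ℝ≥0) (ν : Measure ℝ)
    [IsProbabilityMeasure ν]
    (h : ∀ (n : ℕ) (k : Fin (n + 1) → ℕ), StrictMono (TopologicalSpace.denseSeq ℝ≥0 ∘ k) →
      ∀ (d : Fin n → ℕ) (m : ℕ) (D : Set (Fin m → ℝ)), MeasurableSet D →
        κ (incrementEvent N (TopologicalSpace.denseSeq ℝ≥0 ∘ k) d ∩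
          (fun ω (j : Fin m) => X j ω) ⁻¹' D) =
        poissonWeight r (TopologicalSpace.denseSeq ℝ≥0 ∘ k) d *
          Measure.pi (fun _ : Fin m => ν) D) :
    IsPoissonModel κ N X r ν := by
  intro n τ hτ d m D hD
  choose k hk hk' using exists_denseSeq_gt
  set q : ℝ≥0 → ℕ → ℝ≥0 := fun x j => TopologicalSpace.denseSeq ℝ≥0 (k x j) with hq
  have hYm : Measurable fun ω (j : Fin m) => X j ω :=
    measurable_pi_lambda _ fun j => hX.measurable j
  have hlim : ∀ x, Filter.Tendsto (q x) Filter.atTop (nhds x) := fun x => by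
    refine tendsto_of_tendsto_of_tendsto_of_le_of_le tendsto_const_nhds ?_ (fun j => (hk x j).le)
      fun j => (hk' x j).le
    simpa using (tendsto_const_nhds (x := x)).add
      (tendsto_one_div_add_atTop_nhds_zero_nat (𝕜 := ℝ≥0))
  have hcount : ∀ x ω, ∀ᶠ j in Filter.atTop, N (q x j) ω = N x ω := fun x ω => by
    obtain ⟨s, hs, hs'⟩ := hN.right_cont ω x
    filter_upwards [(hlim x).eventually (gt_mem_nhds hs)] with j hj
    exact le_antisymm (hs' ▸ hN.mono ω hj.le) (hN.mono ω (hk x j).le)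
  have hstrict : ∀ᶠ j in Filter.atTop, StrictMono fun i => q (τ i) j := by
    have : ∀ᶠ j in Filter.atTop, ∀ i : Fin n, q (τ i.castSucc) j < q (τ i.succ) j :=
      Filter.eventually_all.2 fun i =>
        (hlim _).eventually_lt (hlim _) (hτ i.castSucc_lt_succ)
    exact this.mono fun j hj => Fin.strictMono_iff_lt_succ.2 hj
  have hleft : Filter.Tendsto (fun j => κ (incrementEvent N (fun i => q (τ i) j) d ∩
      (fun ω (j : Fin m) => X j ω) ⁻¹' D)) Filter.atTop
      (nhds (κ (incrementEvent N τ d ∩ (fun ω (j : Fin m) => X j ω) ⁻¹' D))) := by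
    refine tendsto_measure_of_tendsto_indicator_of_isFiniteMeasure _ κ
      (fun j => (measurableSet_incrementEvent hN _ d).inter (hYm hD)) fun ω => ?_
    have : ∀ᶠ j in Filter.atTop, ∀ i, N (q (τ i) j) ω = N (τ i) ω :=
      Filter.eventually_all.2 fun i => hcount _ _
    filter_upwards [this] with j hj
    simp [incrementEvent, hj]
  have hright : Filter.Tendsto (fun j => poissonWeight r (fun i => q (τ i) j) d *
      Measure.pi (fun _ : Fin m => ν) D) Filter.atTop
      (nhds (poissonWeight r τ d * Measure.pi (fun _ : Fin m => ν) D)) := by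
    refine ENNReal.Tendsto.mul_const ?_ (Or.inr (measure_ne_top _ _))
    refine ENNReal.tendsto_finsetProd_of_ne_top _ (fun i _ => ?_) fun i _ => measure_ne_top _ _
    exact ((continuous_poissonMeasure (d i)).tendsto _).comp
      (((hlim (τ i.succ)).sub (hlim (τ i.castSucc))).mul_const r)
  refine tendsto_nhds_unique (hleft.congr' ?_) hright
  filter_upwards [hstrict] with j hj
  exact h n (fun i => k (τ i) j) hj d m D hD

theorem IsCMPP.ae_isPoissonModel {g : ℝ → ℝ} {κ : Kernel ℝ Ω} (hN : IsCountingProcess N)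
    (hX : IsSizeProcess X) (hΘ : Measurable Θ) (h1 : CondA1 μ N X Θ) (h2 : CondA2 μ X Θ)
    (hS : IsCMPP μ N X Θ g) (hκ : IsConsistentRCP κ μ Θ) (hg : Measurable g) :
    ∀ᵐ θ ∂μ.map Θ, IsPoissonModel (κ θ) N X (g θ).toNNReal (μ.map (X 0)) := by
  have := Measure.isProbabilityMeasure_map (μ := μ) (hX.measurable 0).aemeasurable
  have h : ∀ᵐ θ ∂μ.map Θ, ∀ (n : ℕ) (k : Fin (n + 1) → ℕ) (d : Fin n → ℕ) (m : ℕ),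
      StrictMono (TopologicalSpace.denseSeq ℝ≥0 ∘ k) → ∀ D : Set (Fin m → ℝ), MeasurableSet D →
        κ θ (incrementEvent N (TopologicalSpace.denseSeq ℝ≥0 ∘ k) d ∩
          (fun ω (j : Fin m) => X j ω) ⁻¹' D) =
        poissonWeight (g θ).toNNReal (TopologicalSpace.denseSeq ℝ≥0 ∘ k) d *
          Measure.pi (fun _ : Fin m => μ.map (X 0)) D := by
    -- Times from the dense sequence are encoded by integer indices, so only countably many null
    -- sets are united.
    refine ae_all_iff.2 fun n => ae_all_iff.2 fun k => ae_all_iff.2 fun d =>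
      ae_all_iff.2 fun m => ?_
    by_cases hk : StrictMono (TopologicalSpace.denseSeq ℝ≥0 ∘ k)
    · filter_upwards [ae_incrementEvent_inter hN hX hΘ h1 h2 hS hκ hg hk d m] with θ hθ _
      exact hθ
    · exact Filter.Eventually.of_forall fun θ hk' => absurd hk' hk
  filter_upwards [h] with θ hθ
  have := hκ.prob θ
  exact isPoissonModel_of_denseSeq hN hX _ _ fun n k hk d m D hD => hθ n k d m hk D hD

end Conditional

/-! ### Positive real-valued densities -/

section Densities

variable {μ ν : Measure ℝ} {f f' : ℝ → ℝ}

theorem IsPosDensity.measEquiv (h : IsPosDensity f ν μ) : MeasEquiv ν μ := by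
  rw [h.density]
  refine ⟨withDensity_absolutelyContinuous _ _, withDensity_absolutelyContinuous'
    h.measurable.ennreal_ofReal.aemeasurable ?_⟩
  filter_upwards [h.pos] with x hx
  simpa using hx

theorem exists_isPosDensity [IsFiniteMeasure μ] [IsFiniteMeasure ν] (h : MeasEquiv ν μ) :
    ∃ f, IsPosDensity f ν μ ∧ ∀ x, 0 ≤ f x := by
  refine ⟨fun x => (ν.rnDeriv μ x).toReal,
    ⟨(Measure.measurable_rnDeriv ν μ).ennreal_toReal, ?_, ?_⟩,
    fun x => ENNReal.toReal_nonneg⟩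
  · filter_upwards [Measure.rnDeriv_pos' h.2, Measure.rnDeriv_lt_top ν μ] with x h1 h2
    exact ENNReal.toReal_pos h1.ne' h2.ne
  · conv_lhs => rw [← Measure.withDensity_rnDeriv_eq ν μ h.1]
    refine withDensity_congr_ae ?_
    filter_upwards [Measure.rnDeriv_lt_top ν μ] with x hx
    rw [ENNReal.ofReal_toReal hx.ne]

theorem IsPosDensity.ae_eq [IsFiniteMeasure ν] (h : IsPosDensity f ν μ)
    (h' : IsPosDensity f' ν μ) :
    f =ᵐ[μ] f' := by
  have hfin : ∫⁻ x, ENNReal.ofReal (f x) ∂μ ≠ ∞ := by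
    rw [← setLIntegral_univ, ← withDensity_apply _ MeasurableSet.univ, ← h.density]
    exact measure_ne_top _ _
  have := (withDensity_eq_iff h.measurable.ennreal_ofReal.aemeasurable
    h'.measurable.ennreal_ofReal.aemeasurable hfin).1 (h.density.symm.trans h'.density)
  filter_upwards [this, h.pos, h'.pos] with x hx h1 h2
  exact (ENNReal.ofReal_eq_ofReal_iff h1.le h2.le).1 hx

end Densities

/-! ### Density processes, martingales and progressive equivalence -/

section Martingale

variable {Ω : Type*} [mΩ : MeasurableSpace Ω]

/-- For `A` in `ℱ s` and `s ≤ t`, the integrals of `M s` and `M t` over `A` are both `ν A`; this is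
the martingale property. -/
theorem setIntegral_eq_and_martingale {μ ν : Measure Ω} [IsFiniteMeasure μ] [IsFiniteMeasure ν]
    {ℱ : Filtration ℝ≥0 mΩ} {M : ℝ≥0 → Ω → ℝ} (hM : ∀ t, Measurable[ℱ t] (M t))
    (h0 : ∀ t ω, 0 ≤ M t ω)
    (h : ∀ t A, MeasurableSet[ℱ t] A → ν A = ∫⁻ ω in A, ENNReal.ofReal (M t ω) ∂μ) :
    (∀ s t, s ≤ t → ∀ A, MeasurableSet[ℱ s] A → ν.real A = ∫ ω in A, M t ω ∂μ) ∧
      Martingale M ℱ μ := by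
  have hMm : ∀ t, Measurable (M t) := fun t => (hM t).mono (ℱ.le t) le_rfl
  have hint : ∀ t, Integrable (M t) μ := fun t => by
    refine ⟨(hMm t).aestronglyMeasurable, ?_⟩
    rw [hasFiniteIntegral_iff_ofReal (Filter.Eventually.of_forall (h0 t)), ← setLIntegral_univ,
      ← h t _ MeasurableSet.univ]
    exact measure_lt_top _ _
  have hset : ∀ s t, s ≤ t → ∀ A, MeasurableSet[ℱ s] A → ν.real A = ∫ ω in A, M t ω ∂μ := by
    intro s t hst A hA
    rw [integral_eq_lintegral_of_nonneg_ae (Filter.Eventually.of_forall (h0 t))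
      (hMm t).aestronglyMeasurable, ← h t A (ℱ.mono hst _ hA)]
    rfl
  refine ⟨hset, fun t => (hM t).stronglyMeasurable, fun s t hst => ?_⟩
  refine (ae_eq_condExp_of_forall_setIntegral_eq (ℱ.le s) (hint t)
    (fun A _ _ => (hint s).integrableOn) (fun A hA _ => ?_)
    (hM s).stronglyMeasurable.aestronglyMeasurable).symm
  rw [← hset s s le_rfl A hA, ← hset s t hst A hA]

theorem progEquiv_of_setIntegral_eq {P Q : Measure Ω} [IsFiniteMeasure P] [IsFiniteMeasure Q]
    {ℱ : Filtration ℝ≥0 mΩ} {M : ℝ≥0 → Ω → ℝ} (hM : ∀ t, Integrable (M t) P)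
    (hpos : ∀ t, ∀ᵐ ω ∂P, 0 < M t ω)
    (h : ∀ t A, MeasurableSet[ℱ t] A → Q.real A = ∫ ω in A, M t ω ∂P) : ProgEquiv ℱ Q P := by
  intro t
  constructor <;> refine Measure.AbsolutelyContinuous.mk fun A hA hA0 => ?_
  · rw [trim_measurableSet_eq _ hA] at hA0 ⊢
    rw [← measureReal_eq_zero_iff, h t A hA, setIntegral_measure_zero _ hA0]
  · rw [trim_measurableSet_eq _ hA] at hA0 ⊢
    have h1 := h t A hA
    rw [measureReal_def, hA0, ENNReal.toReal_zero, eq_comm, setIntegral_eq_zero_iff_of_nonneg_ae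
      (ae_restrict_of_ae ((hpos t).mono fun ω hω => hω.le)) (hM t).integrableOn] at h1
    rw [measure_eq_zero_iff_ae_notMem]
    filter_upwards [(ae_restrict_iff' (ℱ.le t _ hA)).1 h1, hpos t] with ω h2 h3 h4
    exact h3.ne' (h2 h4)

end Martingale

/-! ### Global change of measure and the converse implications -/

section Main

theorem fibreDensity_eq_likelihood {Ω : Type*} {N : ℝ≥0 → Ω → ℕ} {X : ℕ → Ω → ℝ} {α γ : ℝ → ℝ}
    {θ : ℝ} (hθ : 0 < θ) (t : ℝ≥0) (ω : Ω) :
    fibreDensity N X α γ θ t ω = likelihood N X (α θ) γ θ.toNNReal t ω := by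
  simp only [fibreDensity, likelihood, betaAggregate, betaFn, Real.coe_toNNReal θ hθ.le]

variable {Ω : Type*} [mΩ : MeasurableSpace Ω] {N : ℝ≥0 → Ω → ℕ} {X : ℕ → Ω → ℝ} {Θ : Ω → ℝ}
  {P Q : Measure Ω} {α γ α' γ' : ℝ → ℝ}

theorem IsLogDensity.map_size_eq (h : IsLogDensity P Q X γ) (hX : IsSizeProcess X) :
    Q.map (X 0) = (P.map (X 0)).withDensity fun x => ENNReal.ofReal (Real.exp (γ x)) := by
  obtain ⟨f, hf, hγ⟩ := h
  have hpos : ∀ᵐ x ∂P.map (X 0), 0 < x := by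
    rw [ae_map_iff (hX.measurable 0).aemeasurable measurableSet_Ioi]
    exact Filter.Eventually.of_forall fun ω => hX.pos 0 ω
  rw [hf.density]
  refine withDensity_congr_ae ?_
  filter_upwards [hf.pos, hpos] with x h1 h2
  rw [hγ x h2 h1, Real.exp_log h1]

theorem IsLogDensity.ae_eq [IsFiniteMeasure P] [IsFiniteMeasure Q] (h : IsLogDensity P Q X γ)
    (h' : IsLogDensity P Q X γ') (hX : IsSizeProcess X) (hγ : Measurable γ) (hγ' : Measurable γ') :
    γ =ᵐ[P.map (X 0)] γ' := by
  have heq := (h.map_size_eq hX).symm.trans (h'.map_size_eq hX)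
  have hfin : ∫⁻ x, ENNReal.ofReal (Real.exp (γ x)) ∂P.map (X 0) ≠ ∞ := by
    rw [← setLIntegral_univ, ← withDensity_apply _ MeasurableSet.univ, ← h.map_size_eq hX]
    exact measure_ne_top _ _
  have := (withDensity_eq_iff (Real.measurable_exp.comp hγ).ennreal_ofReal.aemeasurable
    (Real.measurable_exp.comp hγ').ennreal_ofReal.aemeasurable hfin).1 heq
  filter_upwards [this] with x hx
  exact Real.exp_injective ((ENNReal.ofReal_eq_ofReal_iff (Real.exp_pos _).le
    (Real.exp_pos _).le).1 hx)

theorem betaAEEq_of_ae_eq [SFinite P] (hα : α' =ᵐ[P.map Θ] α) (hγ : γ' =ᵐ[P.map (X 0)] γ) :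
    BetaAEEq P X Θ α γ α' γ' := by
  have h1 := Measure.quasiMeasurePreserving_fst (μ := P.map (X 0)) (ν := P.map Θ) |>.ae hγ
  have h2 := Measure.quasiMeasurePreserving_snd (μ := P.map (X 0)) (ν := P.map Θ) |>.ae hα
  filter_upwards [h1, h2] with p h1 h2
  rw [betaFn, betaFn, h1, h2]

theorem exists_isFClass [IsProbabilityMeasure P] [IsProbabilityMeasure Q] (hX : IsSizeProcess X)
    {g : ℝ → ℝ} (hg : Measurable g) (hgpos : ∀ θ, 0 < θ → 0 < g θ)
    (h : MeasEquiv (Q.map (X 0)) (P.map (X 0))) :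
    ∃ α γ, IsFClass P X α γ ∧ (∀ θ, 0 < θ → g θ = θ * Real.exp (α θ)) ∧ IsLogDensity P Q X γ := by
  have := Measure.isProbabilityMeasure_map (μ := Q) (hX.measurable 0).aemeasurable
  obtain ⟨f, hf, -⟩ := exists_isPosDensity h
  have hlog : IsLogDensity P Q X fun x => Real.log (f x) := ⟨f, hf, fun _ _ _ => rfl⟩
  have hγ : Measurable fun x => Real.log (f x) := Real.measurable_log.comp hf.measurable
  -- `α` is forced by `g θ = θ e^{α θ}`; the normalization of `γ = log f` is the total mass of
  -- `Q_{X_1}`.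
  refine ⟨fun θ => Real.log (g θ / θ), _, ⟨Real.measurable_log.comp (hg.div measurable_id), hγ, ?_⟩,
    fun θ hθ => ?_, hlog⟩
  · have hexp := Real.measurable_exp.comp hγ
    rw [integral_eq_lintegral_of_nonneg_ae
      (Filter.Eventually.of_forall fun ω => (Real.exp_pos _).le)
      (hexp.comp (hX.measurable 0)).aestronglyMeasurable,
      ← lintegral_map (f := fun x => ENNReal.ofReal (Real.exp (Real.log (f x))))
        hexp.ennreal_ofReal (hX.measurable 0), ← setLIntegral_univ,
      ← withDensity_apply _ MeasurableSet.univ, ← hlog.map_size_eq hX, measure_univ,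
      ENNReal.toReal_one]
  · rw [Real.exp_log (div_pos (hgpos θ hθ) hθ), mul_div_cancel₀ _ hθ.ne']

theorem measurable_fibreDensity (hN : IsCountingProcess N) (hX : IsSizeProcess X)
    (hΘ : Measurable Θ) (hγ : Measurable γ) (θ : ℝ) (t : ℝ≥0) :
    Measurable[filtration N X Θ hN hX hΘ t] (fibreDensity N X α γ θ t) :=
  Real.measurable_exp.comp ((measurable_sum_size_filtration hN hX hΘ
    (measurable_const.add hγ : Measurable fun x => α θ + γ x) t).sub measurable_const)

theorem measurable_globalDensity (hN : IsCountingProcess N) (hX : IsSizeProcess X)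
    (hΘ : Measurable Θ) {ξ : ℝ → ℝ} (hα : Measurable α) (hγ : Measurable γ) (hξ : Measurable ξ)
    (t : ℝ≥0) :
    Measurable[filtration N X Θ hN hX hΘ t] (globalDensity N X Θ α γ ξ t) := by
  have hΘ' := measurable_theta_filtration hN hX hΘ t
  have hsum := measurable_sum_size_filtration hN hX hΘ hγ t
  have hcount := measurable_sum_size_filtration hN hX hΘ (measurable_const (a := (1 : ℝ))) t
  -- As `Θ` is random here, `α(Θ)` is pulled out of the sum, its coefficient `N_t` being written as
  -- a sum of ones.
  have heq : globalDensity N X Θ α γ ξ t = fun ω => ξ (Θ ω) * Real.exp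
      ((∑ k ∈ Finset.range (N t ω), (1 : ℝ)) * α (Θ ω) + ∑ k ∈ Finset.range (N t ω), γ (X k ω) -
        t * Θ ω * (Real.exp (α (Θ ω)) - 1)) := by
    funext ω
    simp [globalDensity, fibreDensity, betaAggregate, betaFn, Finset.sum_add_distrib]
  rw [heq]
  exact (hξ.comp hΘ').mul (Real.measurable_exp.comp (((hcount.mul (hα.comp hΘ')).add hsum).sub
    ((measurable_const.mul hΘ').mul ((Real.measurable_exp.comp (hα.comp hΘ')).sub
      measurable_const))))

theorem lintegral_rcp {μ : Measure Ω} {κ : Kernel ℝ Ω} (h : IsConsistentRCP κ μ Θ) {f : Ω → ℝ≥0∞}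
    (hf : Measurable f) : ∫⁻ ω, f ω ∂μ = ∫⁻ θ, ∫⁻ ω, f ω ∂κ θ ∂μ.map Θ := by
  have : μ = (μ.map Θ).bind κ := by
    ext D hD
    rw [Measure.bind_apply hD κ.aemeasurable, h.disint D hD]
  conv_lhs => rw [this]
  exact Measure.lintegral_bind κ.aemeasurable hf.aemeasurable

/-- Otherwise the conditional Poisson probability of a positive count would vanish almost surely,
although its parameter `g(Θ)` is positive. -/
theorem measure_pos_one_le_count [IsProbabilityMeasure Q] {g : ℝ → ℝ} (hN : IsCountingProcess N)
    (hΘ : Measurable Θ) (hgpos : ∀ θ, 0 < θ → 0 < g θ)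
    (hpos : ∀ᵐ ω ∂Q, 0 < Θ ω) (h : IsMPP Q N Θ g) : Q {ω | 1 ≤ N 1 ω} ≠ 0 := by
  intro h0
  have hN1 : MeasurableSet {ω | N 1 ω ∈ Set.Ici 1} := (hN.measurable 1) measurableSet_Ici
  have h1 := setIntegral_condProb (μ := Q) hΘ hN1 MeasurableSet.univ
  rw [Set.preimage_univ, Set.inter_univ, setIntegral_univ, measureReal_def,
    show Q {ω | N 1 ω ∈ Set.Ici 1} = 0 from h0,
    ENNReal.toReal_zero, integral_congr_ae (h.poisson 1 one_pos (Set.Ici 1)),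
    integral_eq_zero_iff_of_nonneg (fun _ => measureReal_nonneg)] at h1
  swap
  · refine Integrable.congr ?_ (h.poisson 1 one_pos (Set.Ici 1))
    exact integrable_condExp
  obtain ⟨ω, hω, hω'⟩ := (h1.and hpos).exists
  have hr : 0 < 1 * (g (Θ ω)).toNNReal := by simpa using hgpos _ hω'
  have h2 := poissonMeasure_real_singleton_pos 1 hr
  have h3 : (poissonMeasure (1 * (g (Θ ω)).toNNReal)).real {1} ≤
      (poissonMeasure (1 * (g (Θ ω)).toNNReal)).real (Set.Ici 1) :=
    measureReal_mono (by simp)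
  exact (h2.trans_le h3).ne' hω

/-- `F_1` sees `X 0` only on `N_1 ≥ 1`. Independence of `N` and `X` under `Q` factors the
probability of this event with `X 0 ∈ B`, and the first factor is not zero. -/
theorem absolutelyContinuous_map_size [IsProbabilityMeasure Q] {g : ℝ → ℝ}
    (hN : IsCountingProcess N) (hX : IsSizeProcess X) (hΘ : Measurable Θ)
    (hgpos : ∀ θ, 0 < θ → 0 < g θ) (hpos : ∀ᵐ ω ∂Q, 0 < Θ ω) (h : IsCMPP Q N X Θ g)
    (hQP : Q.trim ((filtration N X Θ hN hX hΘ).le 1) ≪ P.trim ((filtration N X Θ hN hX hΘ).le 1)) :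
    Q.map (X 0) ≪ P.map (X 0) := by
  refine Measure.AbsolutelyContinuous.mk fun B hB hB0 => ?_
  rw [Measure.map_apply (hX.measurable 0) hB] at hB0 ⊢
  have hA := measurableSet_lt_count_and_size_mem hN hX hΘ 0 1 hB
  have hP0 : P {ω | 0 < N 1 ω ∧ X 0 ω ∈ B} = 0 := measure_mono_null (fun ω hω => hω.2) hB0
  have hQ0 := hQP (by rwa [trim_measurableSet_eq _ hA])
  rw [trim_measurableSet_eq _ hA] at hQ0
  have hm1 : MeasurableSet {n : ℝ≥0 → ℕ | 1 ≤ n 1} := measurable_pi_apply 1 measurableSet_Ici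
  have hm2 : MeasurableSet {x : ℕ → ℝ | x 0 ∈ B} := measurable_pi_apply 0 hB
  have hind := h.risk.indep_proc.measure_inter_preimage_eq_mul _ _ hm1 hm2
  have hz : Q {ω | 1 ≤ N 1 ω} * Q (X 0 ⁻¹' B) = 0 := hind.symm.trans hQ0
  exact (mul_eq_zero.1 hz).resolve_left
    (measure_pos_one_le_count hN hΘ hgpos hpos h.mpp)

theorem absolutelyContinuous_map_theta (hN : IsCountingProcess N) (hX : IsSizeProcess X)
    (hΘ : Measurable Θ)
    (hQP : Q.trim ((filtration N X Θ hN hX hΘ).le 0) ≪ P.trim ((filtration N X Θ hN hX hΘ).le 0)) :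
    Q.map Θ ≪ P.map Θ := by
  refine Measure.AbsolutelyContinuous.mk fun B hB hB0 => ?_
  rw [Measure.map_apply hΘ hB] at hB0 ⊢
  have hA := measurable_theta_filtration hN hX hΘ 0 hB
  rw [← trim_measurableSet_eq ((filtration N X Θ hN hX hΘ).le 0) hA] at hB0 ⊢
  exact hQP hB0

/-- Disintegrate: `Q A` is the `P_Θ`-integral of `ξ θ * Qθ θ A`. Inserting the fibre density and
using `Θ = θ` under `Pθ θ` turns the integrand into the fibre integral of `globalDensity`. -/
theorem global_change_of_measure (hN : IsCountingProcess N) (hX : IsSizeProcess X)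
    (hΘ : Measurable Θ) {Pθ Qθ : Kernel ℝ Ω} (hPpos : ∀ᵐ ω ∂P, 0 < Θ ω)
    (hPθ : IsConsistentRCP Pθ P Θ)
    (hQθ : IsConsistentRCP Qθ Q Θ) (hα : Measurable α) (hγ : Measurable γ) {ξ : ℝ → ℝ}
    (hξ : IsPosDensity ξ (Q.map Θ) (P.map Θ))
    (h : ∀ᵐ θ ∂P.map Θ, 0 < θ → ∀ t A, MeasurableSet[filtration N X Θ hN hX hΘ t] A →
      Qθ θ A = ∫⁻ ω in A, ENNReal.ofReal (fibreDensity N X α γ θ t ω) ∂Pθ θ)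
    (t : ℝ≥0) {A : Set Ω} (hA : MeasurableSet[filtration N X Θ hN hX hΘ t] A) :
    Q A = ∫⁻ ω in A, ENNReal.ofReal (globalDensity N X Θ α γ ξ t ω) ∂P := by
  have hAm : MeasurableSet A := (filtration N X Θ hN hX hΘ).le t _ hA
  have hGm := ((measurable_globalDensity hN hX hΘ hα hγ hξ.measurable t).mono
    ((filtration N X Θ hN hX hΘ).le t) le_rfl).ennreal_ofReal
  have hpos : ∀ᵐ θ ∂P.map Θ, 0 < θ := by
    rwa [ae_map_iff hΘ.aemeasurable measurableSet_Ioi]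
  rw [← hQθ.disint A hAm, hξ.density, lintegral_withDensity_eq_lintegral_mul _
    hξ.measurable.ennreal_ofReal (Kernel.measurable_coe Qθ hAm), ← lintegral_indicator hAm,
    lintegral_rcp hPθ (hGm.indicator hAm)]
  refine lintegral_congr_ae ?_
  filter_upwards [h, hPθ.ae_ae_eq hΘ, hpos, hξ.pos] with θ h1 h2 h3 h4
  rw [lintegral_indicator hAm, Pi.mul_apply, h1 h3 t A hA, ← lintegral_const_mul _
    ((measurable_fibreDensity hN hX hΘ hγ θ t).mono
      ((filtration N X Θ hN hX hΘ).le t) le_rfl).ennreal_ofReal]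
  refine lintegral_congr_ae (ae_restrict_of_ae ?_)
  filter_upwards [h2] with ω hω
  rw [globalDensity, hω, ENNReal.ofReal_mul h4.le]

variable [IsProbabilityMeasure P] [IsProbabilityMeasure Q] {g : ℝ → ℝ} {Pθ Qθ : Kernel ℝ Ω}

/-- The fibre properties of `Q` hold off a `Q_Θ`-null set, which is `P_Θ`-null by `hΘPQ`; at the
remaining positive θ the two Poisson models are compared. -/
theorem ae_fibre_change_of_measure (hN : IsCountingProcess N) (hX : IsSizeProcess X)
    (hΘ : Measurable Θ) (hPa1 : CondA1 P N X Θ) (hPa2 : CondA2 P X Θ)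
    (hPS : IsCMPP P N X Θ fun θ => θ) (hPθ : IsConsistentRCP Pθ P Θ) (hg : Measurable g)
    (hQa1 : CondA1 Q N X Θ) (hQa2 : CondA2 Q X Θ) (hQS : IsCMPP Q N X Θ g)
    (hQθ : IsConsistentRCP Qθ Q Θ) (hΘPQ : P.map Θ ≪ Q.map Θ) (hγ : Measurable γ)
    (hα : ∀ θ, 0 < θ → g θ = θ * Real.exp (α θ)) (hlog : IsLogDensity P Q X γ) :
    ∀ᵐ θ ∂P.map Θ, 0 < θ → ∀ t A, MeasurableSet[filtration N X Θ hN hX hΘ t] A →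
      Qθ θ A = ∫⁻ ω in A, ENNReal.ofReal (fibreDensity N X α γ θ t ω) ∂Pθ θ := by
  have := Measure.isProbabilityMeasure_map (μ := P) (hX.measurable 0).aemeasurable
  have := Measure.isProbabilityMeasure_map (μ := Q) (hX.measurable 0).aemeasurable
  filter_upwards [hPS.ae_isPoissonModel hN hX hΘ hPa1 hPa2 hPθ measurable_id, hPθ.ae_ae_eq hΘ,
    hΘPQ.ae_le (hQS.ae_isPoissonModel hN hX hΘ hQa1 hQa2 hQθ hg), hΘPQ.ae_le (hQθ.ae_ae_eq hΘ)]
    with θ h1 h2 h3 h4 hθ t A hA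
  have := hQθ.prob θ
  simp_rw [fibreDensity_eq_likelihood hθ]
  refine h1.measure_eq_setLIntegral hN hX hΘ h3 h2 h4 ?_ hγ (hlog.map_size_eq hX) t hA
  rw [Real.coe_toNNReal θ hθ.le, hα θ hθ, Real.coe_toNNReal _ (by positivity)]

end Main

end CMPP

open CMPP in
theorem proposition3p4 {Ω : Type*} [mΩ : MeasurableSpace Ω]
    (P Q : Measure Ω) [IsProbabilityMeasure P] [IsProbabilityMeasure Q]
    (N : ℝ≥0 → Ω → ℕ) (X : ℕ → Ω → ℝ) (Θ : Ω → ℝ)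
    (hN : IsCountingProcess N) (hX : IsSizeProcess X) (hΘ : Measurable Θ)
    -- the initial measure `P`
    (hPpos : ∀ᵐ ω ∂P, 0 < Θ ω)
    (hPa1 : CondA1 P N X Θ) (hPa2 : CondA2 P X Θ)
    (hPS : IsCMPP P N X Θ fun θ => θ)
    (Pθ : Kernel ℝ Ω) (hPθ : IsConsistentRCP Pθ P Θ)
    -- the measure `Q`
    (g : ℝ → ℝ) (hg : Measurable g) (hgpos : ∀ θ, 0 < θ → 0 < g θ)
    (hQpos : ∀ᵐ ω ∂Q, 0 < Θ ω)
    (hQa1 : CondA1 Q N X Θ) (hQa2 : CondA2 Q X Θ)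
    (hQS : IsCMPP Q N X Θ g)
    (Qθ : Kernel ℝ Ω) (hQθ : IsConsistentRCP Qθ Q Θ) :
    List.TFAE [
      -- (i)
      ProgEquiv (filtration N X Θ hN hX hΘ) Q P,
      -- (ii)
      MeasEquiv (Q.map (X 0)) (P.map (X 0)) ∧ MeasEquiv (Q.map Θ) (P.map Θ),
      -- (iii)
      MeasEquiv (Q.map Θ) (P.map Θ) ∧
      ∃ α γ : ℝ → ℝ,
        (IsFClass P X α γ ∧ (∀ θ, 0 < θ → g θ = θ * Real.exp (α θ)) ∧ IsLogDensity P Q X γ) ∧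
        (∀ α' γ' : ℝ → ℝ,
          IsFClass P X α' γ' → (∀ θ, 0 < θ → g θ = θ * Real.exp (α' θ)) →
          IsLogDensity P Q X γ' → BetaAEEq P X Θ α γ α' γ') ∧
        ∃ V : Set ℝ, MeasurableSet V ∧ P.map Θ V = 0 ∧ ∀ θ, 0 < θ → θ ∉ V →
          (∀ s t : ℝ≥0, s ≤ t → ∀ A, MeasurableSet[filtration N X Θ hN hX hΘ s] A →
            (Qθ θ).real A = ∫ ω in A, fibreDensity N X α γ θ t ω ∂(Pθ θ)) ∧
          Martingale (fibreDensity N X α γ θ) (filtration N X Θ hN hX hΘ) (Pθ θ),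
      -- (iv)
      ∃ α γ ξ : ℝ → ℝ,
        (IsFClass P X α γ ∧ IsRClass P Θ ξ ∧ IsPosDensity ξ (Q.map Θ) (P.map Θ) ∧
          (∀ ω, 0 < Θ ω → g (Θ ω) = Θ ω * Real.exp (α (Θ ω))) ∧ IsLogDensity P Q X γ) ∧
        (∀ α' γ' ξ' : ℝ → ℝ,
          IsFClass P X α' γ' → IsRClass P Θ ξ' → IsPosDensity ξ' (Q.map Θ) (P.map Θ) →
          (∀ ω, 0 < Θ ω → g (Θ ω) = Θ ω * Real.exp (α' (Θ ω))) →
          IsLogDensity P Q X γ' →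
          BetaAEEq P X Θ α γ α' γ' ∧ ∀ᵐ θ ∂(P.map Θ), ξ' θ = ξ θ) ∧
        (∀ s t : ℝ≥0, s ≤ t → ∀ A, MeasurableSet[filtration N X Θ hN hX hΘ s] A →
          Q.real A = ∫ ω in A, globalDensity N X Θ α γ ξ t ω ∂P) ∧
        Martingale (globalDensity N X Θ α γ ξ) (filtration N X Θ hN hX hΘ) P] := by
  have hΘPm := Measure.isProbabilityMeasure_map (μ := P) hΘ.aemeasurable
  have hΘQm := Measure.isProbabilityMeasure_map (μ := Q) hΘ.aemeasurable
  have hθpos : ∀ᵐ θ ∂P.map Θ, 0 < θ := by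
    rwa [ae_map_iff hΘ.aemeasurable measurableSet_Ioi]
  have fibre : ∀ {α γ : ℝ → ℝ}, MeasEquiv (Q.map Θ) (P.map Θ) → Measurable γ →
      (∀ θ, 0 < θ → g θ = θ * Real.exp (α θ)) → IsLogDensity P Q X γ →
      ∀ᵐ θ ∂P.map Θ, 0 < θ → ∀ t A, MeasurableSet[filtration N X Θ hN hX hΘ t] A →
        Qθ θ A = ∫⁻ ω in A, ENNReal.ofReal (fibreDensity N X α γ θ t ω) ∂Pθ θ :=
    fun hE hγ hα hlog => ae_fibre_change_of_measure hN hX hΘ hPa1 hPa2 hPS hPθ hg hQa1 hQa2 hQS hQθ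
      hE.2 hγ hα hlog
  tfae_have 1 → 2 := fun h =>
    ⟨⟨absolutelyContinuous_map_size hN hX hΘ hgpos hQpos hQS (h 1).1,
      -- The same lemma with the two measures exchanged, the rate function under `P` being the
      -- identity.
      absolutelyContinuous_map_size hN hX hΘ (fun _ hθ => hθ) hPpos hPS (h 1).2⟩,
      absolutelyContinuous_map_theta hN hX hΘ (h 0).1,
      absolutelyContinuous_map_theta hN hX hΘ (h 0).2⟩
  tfae_have 2 → 3 := by
    rintro ⟨hEX, hE⟩
    refine ⟨hE, ?_⟩
    obtain ⟨α, γ, hF, hα, hlog⟩ := exists_isFClass hX hg hgpos hEX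
    refine ⟨α, γ, ⟨hF, hα, hlog⟩, fun α' γ' hF' hα' hlog' => ?_, ?_⟩
    · refine betaAEEq_of_ae_eq ?_
        (hlog'.ae_eq hlog hX hF'.measurable_gamma hF.measurable_gamma)
      filter_upwards [hθpos] with θ hθ
      exact Real.exp_injective (mul_left_cancel₀ hθ.ne' ((hα' θ hθ).symm.trans (hα θ hθ)))
    · have hae := fibre hE hF.measurable_gamma hα hlog
      -- The exceptional set need not be measurable, so it is enlarged to a measurable null set.
      obtain ⟨V, hV, hVm, hV0⟩ := exists_measurable_superset_of_null (ae_iff.1 hae)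
      refine ⟨V, hVm, hV0, fun θ hθ hθV => ?_⟩
      have hθ' := not_not.1 (fun hn => hθV (hV hn)) hθ
      have := hPθ.prob θ
      have := hQθ.prob θ
      exact setIntegral_eq_and_martingale
        (measurable_fibreDensity hN hX hΘ hF.measurable_gamma θ)
        (fun _ _ => (Real.exp_pos _).le) hθ'
  tfae_have 3 → 2 := by
    rintro ⟨hE, α, γ, ⟨-, -, f, hf, -⟩, -⟩
    exact ⟨hf.measEquiv, hE⟩
  tfae_have 2 → 4 := by
    rintro ⟨hEX, hE⟩
    obtain ⟨α, γ, hF, hα, hlog⟩ := exists_isFClass hX hg hgpos hEX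
    obtain ⟨ξ, hξ, hξ0⟩ := exists_isPosDensity hE
    have hR : IsRClass P Θ ξ := by
      refine ⟨hξ.measurable, hξ.pos, ?_⟩
      rw [integral_eq_lintegral_of_nonneg_ae (Filter.Eventually.of_forall fun ω => hξ0 _)
        (hξ.measurable.comp hΘ).aestronglyMeasurable,
        ← lintegral_map (f := fun θ => ENNReal.ofReal (ξ θ)) hξ.measurable.ennreal_ofReal hΘ,
        ← setLIntegral_univ, ← withDensity_apply _ MeasurableSet.univ,
        ← hξ.density, measure_univ,
        ENNReal.toReal_one]
    refine ⟨α, γ, ξ, ⟨hF, hR, hξ, fun ω hω => hα _ hω, hlog⟩,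
      fun α' γ' ξ' hF' _ hξ' hα' hlog' => ⟨?_, hξ'.ae_eq hξ⟩, ?_⟩
    · refine betaAEEq_of_ae_eq ?_
        (hlog'.ae_eq hlog hX hF'.measurable_gamma hF.measurable_gamma)
      -- In (iv) `α'` is constrained only at values taken by `Θ`, so the comparison is made on `Ω`
      -- and then transferred to the law of `Θ`.
      refine (ae_map_iff hΘ.aemeasurable
        (measurableSet_eq_fun hF'.measurable_alpha hF.measurable_alpha)).2 ?_
      filter_upwards [hPpos] with ω hω
      exact Real.exp_injective (mul_left_cancel₀ hω.ne' ((hα' ω hω).symm.trans (hα _ hω)))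
    · exact setIntegral_eq_and_martingale (measurable_globalDensity hN hX hΘ hF.measurable_alpha
        hF.measurable_gamma hξ.measurable) (fun _ _ => mul_nonneg (hξ0 _) (Real.exp_pos _).le)
        fun t A hA => global_change_of_measure hN hX hΘ hPpos hPθ hQθ hF.measurable_alpha
          hF.measurable_gamma hξ (fibre hE hF.measurable_gamma hα hlog) t hA
  tfae_have 4 → 1 := by
    rintro ⟨α, γ, ξ, ⟨-, hR, -⟩, -, hset, hmart⟩
    refine progEquiv_of_setIntegral_eq hmart.integrable (fun t => ?_)
      fun t A hA => hset t t le_rfl A hA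
    filter_upwards [ae_of_ae_map hΘ.aemeasurable hR.pos] with ω hω
    exact mul_pos hω (Real.exp_pos _)
  tfae_finish
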